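/- Let $Q$ be a smooth 2-manifold, let $H(\alpha)=\tfrac12\langle\alpha,\rho^\sharp(\alpha)\rangle+h(\pi(\alpha))$ be a simple Hamiltonian on $T^*Q$, where $\pi:T^*Q\to Q$ is the projection, $\rho$ is a smooth Riemannian metric on $Q$ and $h\in C^\infty(Q)$, and let $X_H$ be its Hamiltonian vector field with respect to the canonical symplectic form. Let $\xi$ be a nowhere vanishing smooth one-form on $Q$, let $W_q=\operatorname{span}\{\xi(q)\}\subset T_q^*Q$, and let $\mathcal W_\alpha=\operatorname{span}\{\operatorname{vlift}_\alpha(\xi(\pi(\alpha)))\}\subset T_\alpha T^*Q$, where $\operatorname{vlift}_\alpha(\beta)=\frac{d}{dt}\big|_{t=0}(\alpha+t\beta)$, be the corresponding rank-one vertical subbundle (one actuator). Let $\alpha_0=(q_0,0)\in T^*Q$ be a critical point of $X_H$. Fix a chart $\varphi=(x,y)$ of $Q$ centred at $q_0$ and adapted to $W$, i.e. $\varphi(q_0)=(0,0)$ and $W$ is spanned by $dy$ on the domain of $\varphi$, and write in the induced coordinates $$H(x,y,p_x,p_y)=\tfrac12\left(a\,p_x^2+2b\,p_xp_y+c\,p_y^2\right)+h(x,y),$$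 with $a,b,c$ and $h$ functions of $(x,y)$. Suppose that $$\left[b\,h_{xx}+c\,h_{xy}\right](0,0)\neq0\quad\text{or}\quad h_{xx}(0,0)>0 .$$ Then $(H,\mathcal W)$ is stabilizable at $\alpha_0$ by means of a simple Lyapunov function. That is, there exist an open neighbourhood $U$ of $q_0$ in $Q$ and a smooth vector field $Y$ on $T^*U=\pi^{-1}(U)$ with $Y(\alpha)\in\mathcal W_\alpha$ for all $\alpha\in T^*U$, such that $\alpha_0$ is a critical point of $X_H+Y$ and is (Lyapunov) stable for $X_H+Y$; moreover there are a smooth Riemannian metric $g$ on $U$ and $v\in C^\infty(U)$ such that the simple function $V(\alpha)=\tfrac12\langle\alpha,g^\sharp(\alpha)\rangle+v(\pi(\alpha))$ is a Lyapunov function for $X_H+Y$ and $\alpha_0$ on $T^*U$: $V(\alpha_0)=0$, $V(\alpha)>0$ for all $\alpha\in T^*U\setminus\{\alpha_0\}$, and $\langle dV(\alpha),(X_H+Y)(\alpha)\rangle\le0$ for all $\alpha\in T^*U$. -/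

import Mathlib

open Set Filter Topology Bundle
open scoped Manifold ContDiff

noncomputable section

namespace LCB

/-- The model space `ℝ²`. -/
abbrev E2 : Type := EuclideanSpace ℝ (Fin 2)

/-- The model space `(ℝ²)*` of the covectors. -/
abbrev E2Dual : Type := E2 →L[ℝ] ℝ

/-- The model with corners of the cotangent bundle of a 2-manifold. -/
abbrev cotModel : ModelWithCorners ℝ (E2 × E2Dual) (ModelProd E2 E2Dual) :=
  (𝓡 2).prod 𝓘(ℝ, E2Dual)

section Dynamics

variable {F : Type*} [NormedAddCommGroup F] [NormedSpace ℝ F] {K : Type*} [TopologicalSpace K]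
  (J : ModelWithCorners ℝ F K) {P : Type*} [TopologicalSpace P] [ChartedSpace K P]

/-- `α₀` is a (Lyapunov) stable critical point of the vector field `X` given on the open set `D`:
`X α₀ = 0`, and for every neighbourhood `N` of `α₀` there is a neighbourhood `N'` of `α₀` such
that from every point of `N'` there starts a trajectory defined for all `t ≥ 0`, and every
trajectory that starts in `N'` remains in `N` for as long as it is defined. -/
def IsStableAt (X : ∀ α : P, TangentSpace J α) (D : Set P) (α₀ : P) : Prop :=
  α₀ ∈ D ∧ X α₀ = 0 ∧
  ∀ N ∈ 𝓝 α₀, ∃ N' ∈ 𝓝 α₀, ∀ α ∈ N',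
    (∃ Γ : ℝ → P, Γ 0 = α ∧ (∀ t ∈ Ici (0 : ℝ), Γ t ∈ D) ∧
      IsMIntegralCurveOn (I := J) Γ X (Ici 0)) ∧
    (∀ (Γ : ℝ → P) (τ : ℝ), Γ 0 = α → (∀ t ∈ Ico 0 τ, Γ t ∈ D) →
      IsMIntegralCurveOn (I := J) Γ X (Ico 0 τ) → ∀ t ∈ Ico 0 τ, Γ t ∈ N)

/-- The derivative `⟨dV(α), X(α)⟩` of `V` along the vector field `X` at `α`. -/
def derivAlong (V : P → ℝ) (X : ∀ α : P, TangentSpace J α) (α : P) : ℝ :=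
  mfderiv J 𝓘(ℝ, ℝ) V α (X α)

/-- `V` is a Lyapunov function for the vector field `X`, given on the open set `D`, and its
critical point `α₀`. -/
structure IsLyapunovOn (X : ∀ α : P, TangentSpace J α) (V : P → ℝ) (D : Set P) (α₀ : P) :
    Prop where
  mem : α₀ ∈ D
  critical : X α₀ = 0
  smooth : ContMDiffOn J 𝓘(ℝ, ℝ) ∞ V D
  zero : V α₀ = 0
  pos : ∀ α ∈ D, α ≠ α₀ → 0 < V α
  decreasing : ∀ α ∈ D, derivAlong J V X α ≤ 0

end Dynamics

section Cotangent

variable {Q : Type*} [TopologicalSpace Q] [ChartedSpace E2 Q]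

/-- The cotangent bundle `T*Q`. It carries Mathlib's topology and smooth structure of the bundle
of continuous linear maps from the tangent bundle to the trivial line bundle. -/
abbrev CotangentBundle (Q : Type*) [TopologicalSpace Q] [ChartedSpace E2 Q] : Type _ :=
  TotalSpace E2Dual (fun q : Q => TangentSpace (𝓡 2) q →L[ℝ] ℝ)

/-- The point `(q, 0)` of the null section of `T*Q`. -/
def nullPoint (q : Q) : CotangentBundle Q := ⟨q, 0⟩

/-- The part `T*U = π⁻¹(U)` of the cotangent bundle. -/
def cotangentOver (U : Set Q) : Set (CotangentBundle Q) := {α | α.proj ∈ U}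

/-- The differential `T_q Q → ℝ²` at `q` of a chart `φ`. -/
def chartDeriv (φ : OpenPartialHomeomorph Q E2) (q : Q) : TangentSpace (𝓡 2) q →L[ℝ] E2 :=
  mfderiv (𝓡 2) 𝓘(ℝ, E2) φ q

/-- The coordinate vector `∂/∂qⁱ` at `q` of a chart `φ`. -/
def coordVec (φ : OpenPartialHomeomorph Q E2) (i : Fin 2) (q : Q) : TangentSpace (𝓡 2) q :=
  (chartDeriv φ q).inverse (EuclideanSpace.single i (1 : ℝ))

/-- The coordinate differential `dqⁱ` at `q` of a chart `φ`. -/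
def coordDiff (φ : OpenPartialHomeomorph Q E2) (i : Fin 2) (q : Q) :
    TangentSpace (𝓡 2) q →L[ℝ] ℝ :=
  mfderiv (𝓡 2) 𝓘(ℝ, ℝ) (fun q' : Q => φ q' i) q

/-- The coordinates `(q, p)` on `T*Q` induced by a chart `φ` of `Q`: `q` are the coordinates of
the base point, and the momentum `p` is the covector transported to `ℝ²` by `φ`. -/
def cotangentCoord (φ : OpenPartialHomeomorph Q E2) (α : CotangentBundle Q) : E2 × E2Dual :=
  (φ α.proj, α.snd.comp (chartDeriv φ α.proj).inverse)

/-- The symplectic form `dqⁱ ∧ dpᵢ` on `ℝ² × (ℝ²)*`: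
`((u₁, w₁), (u₂, w₂)) ↦ w₂(u₁) - w₁(u₂)`. -/
def stdSymplectic : (E2 × E2Dual) →L[ℝ] (E2 × E2Dual) →L[ℝ] ℝ :=
  (ContinuousLinearMap.apply ℝ ℝ : E2 →L[ℝ] E2Dual →L[ℝ] ℝ).bilinearComp
      (ContinuousLinearMap.fst ℝ E2 E2Dual) (ContinuousLinearMap.snd ℝ E2 E2Dual) -
    (ContinuousLinearMap.id ℝ E2Dual).bilinearComp
      (ContinuousLinearMap.snd ℝ E2 E2Dual) (ContinuousLinearMap.fst ℝ E2 E2Dual)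

/-- A simple (kinetic plus potential) function on `T*Q`:
`α ↦ ½⟨α, g♯(α)⟩ + v(π(α))`, where `g♯` is the inverse of the map `u ↦ g(u, ·)`. -/
def simpleFn (g : ∀ q : Q, TangentSpace (𝓡 2) q →L[ℝ] TangentSpace (𝓡 2) q →L[ℝ] ℝ)
    (v : Q → ℝ) (α : CotangentBundle Q) : ℝ :=
  1 / 2 * α.snd ((g α.proj).inverse α.snd) + v α.proj

/-- The matrix of the kinetic term at `q` in the chart `φ`: the inverse of the matrix
`ρ(∂/∂qⁱ, ∂/∂qʲ)`. -/
def kineticMatrix (g : ∀ q : Q, TangentSpace (𝓡 2) q →L[ℝ] TangentSpace (𝓡 2) q →L[ℝ] ℝ)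
    (φ : OpenPartialHomeomorph Q E2) (q : Q) : Matrix (Fin 2) (Fin 2) ℝ :=
  (Matrix.of fun i j => g q (coordVec φ i q) (coordVec φ j q))⁻¹

/-- Partial derivative with respect to the `i`-th coordinate of `ℝ²`. -/
def partialDeriv (i : Fin 2) (f : E2 → ℝ) (z : E2) : ℝ :=
  fderiv ℝ f z (EuclideanSpace.single i (1 : ℝ))

/-- The condition `[b h_xx + c h_xy](0) ≠ 0` or `h_xx(0) > 0` on the local expression
`½ (a p_x² + 2 b p_x p_y + c p_y²) + h(x, y)` of the simple function given by `g` and `h`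
in a chart `φ` centred at `q₀`. -/
def PositivityCondition
    (g : ∀ q : Q, TangentSpace (𝓡 2) q →L[ℝ] TangentSpace (𝓡 2) q →L[ℝ] ℝ) (h : Q → ℝ)
    (φ : OpenPartialHomeomorph Q E2) (q₀ : Q) : Prop :=
  let b : ℝ := kineticMatrix g φ q₀ 0 1
  let c : ℝ := kineticMatrix g φ q₀ 1 1
  let hloc : E2 → ℝ := fun z => h (φ.symm z)
  let hxx : ℝ := partialDeriv 0 (partialDeriv 0 hloc) 0
  let hxy : ℝ := partialDeriv 1 (partialDeriv 0 hloc) 0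
  b * hxx + c * hxy ≠ 0 ∨ 0 < hxx

variable [IsManifold (𝓡 2) ∞ Q]

/-- The canonical symplectic form of `T*Q` at `α`, which is `dqⁱ ∧ dpᵢ` in the coordinates
`(q, p)` induced by a chart of `Q` around the base point of `α` (any such chart gives the
same form; the preferred chart at the base point is used). -/
def canonicalSymplectic (α : CotangentBundle Q) :
    TangentSpace cotModel α →L[ℝ] TangentSpace cotModel α →L[ℝ] ℝ :=
  let dΦ : (E2 × E2Dual) →L[ℝ] (E2 × E2Dual) :=
    mfderiv cotModel 𝓘(ℝ, E2 × E2Dual) (cotangentCoord (chartAt E2 α.proj)) α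
  stdSymplectic.bilinearComp dΦ dΦ

/-- The Hamiltonian vector field `X_H`, defined by `ω(X_H, ·) = dH` for the canonical symplectic
form `ω` of `T*Q`. -/
def hamiltonianVF (H : CotangentBundle Q → ℝ) (α : CotangentBundle Q) :
    TangentSpace cotModel α :=
  (canonicalSymplectic α).inverse (mfderiv cotModel 𝓘(ℝ, ℝ) H α)

/-- The vertical lift at `α` of a covector `β` at the base point of `α`: the velocity at `t = 0`
of the curve `t ↦ α + t β`. -/
def vlift (α : CotangentBundle Q) (β : TangentSpace (𝓡 2) α.proj →L[ℝ] ℝ) :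
    TangentSpace cotModel α :=
  mfderiv 𝓘(ℝ, ℝ) cotModel
    (fun t : ℝ => (⟨α.proj, α.snd + t • β⟩ : CotangentBundle Q)) 0 (1 : ℝ)

/-- The fibre at `α` of the vertical subbundle of `T T*Q` generated by the one-form `ξ`. -/
def actuation (ξ : ∀ q : Q, TangentSpace (𝓡 2) q →L[ℝ] ℝ) (α : CotangentBundle Q) :
    Submodule ℝ (TangentSpace cotModel α) :=
  Submodule.span ℝ {vlift α (ξ α.proj)}

/-- `ξ` is a smooth differential one-form on `Q`. -/
def IsSmoothForm (ξ : ∀ q : Q, TangentSpace (𝓡 2) q →L[ℝ] ℝ) : Prop :=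
  ContMDiff (𝓡 2) cotModel ∞ (fun q : Q => (⟨q, ξ q⟩ : CotangentBundle Q))

/-- `Y` is smooth as a vector field on the open subset `D` of `T*Q`. -/
def IsSmoothVFOn (Y : ∀ α : CotangentBundle Q, TangentSpace cotModel α)
    (D : Set (CotangentBundle Q)) : Prop :=
  ContMDiffOn cotModel cotModel.tangent ∞
    (fun α => (⟨α, Y α⟩ : TangentBundle cotModel (CotangentBundle Q))) D

/-- `g` is a smooth Riemannian metric on the open subset `U` of `Q`. -/
structure IsRiemannianMetricOn
    (g : ∀ q : Q, TangentSpace (𝓡 2) q →L[ℝ] TangentSpace (𝓡 2) q →L[ℝ] ℝ) (U : Set Q) :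
    Prop where
  symm : ∀ q ∈ U, ∀ u w : TangentSpace (𝓡 2) q, g q u w = g q w u
  pos : ∀ q ∈ U, ∀ u : TangentSpace (𝓡 2) q, u ≠ 0 → 0 < g q u u
  smooth : ContMDiffOn (𝓡 2) ((𝓡 2).prod 𝓘(ℝ, E2 →L[ℝ] E2 →L[ℝ] ℝ)) ∞
    (fun q : Q => TotalSpace.mk' (E2 →L[ℝ] E2 →L[ℝ] ℝ) q (g q)) U

/-- The chart `φ` is adapted to the line subbundle of `T*Q` spanned by `ξ`: over the domain of
`φ` this subbundle is spanned by the differential of the second coordinate. -/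
def IsAdapted (ξ : ∀ q : Q, TangentSpace (𝓡 2) q →L[ℝ] ℝ)
    (φ : OpenPartialHomeomorph Q E2) : Prop :=
  ∀ q ∈ φ.source, Submodule.span ℝ {ξ q} = Submodule.span ℝ {coordDiff φ 1 q}

end Cotangent

end LCB

end

/-! Nothing is dissipated: a force along `dy` is chosen so that a new simple function V, positive
definite near α₀, becomes a first integral of X_H + Y. Lyapunov's theorem then gives stability.

In the adapted chart let V have kinetic matrix (ga, -be; -be, al) with al·ga - be² = 1, and
potential v. A force u dy adds u·w₂ to dV(X_H), where w₂ = ∂V/∂p_y = al p_y - be p_x. So u can be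
found, polynomial in the momenta, once dV(X_H) vanishes on the line w₂ = 0, where p is proportional
to (al, be). Its cubic and linear parts there give two matching conditions: (a al + b be) al_x + (b
al + c be) al_y + a_x al² + 2 b_x al be + c_x be² = 0, (a al + b be) v_x + (b al + c be) v_y = h_x.
The determinant normalisation is what removes ga from the first one (`controlValue_spec`).

These are two equations for three unknowns al, be, v. The freedom is spent by making (al, be)
proportional to (m, n) = K⁻¹d, where K is the kinetic matrix of H and d is a constant vector. Both
conditions then differentiate along d only: ∂_d log al = -S/m with S explicit, and ∂_d v = m h_x /
al. They are solved by integration along parallel lines (`exists_matching`). Adding to v a large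
multiple of the squared transversal distance changes nothing in its equation, and makes v positive
definite as soon as ∂_d² v > 0 at the origin (`exists_lineIntegral_pos`). Since h_x vanishes there,
this asks for d_x h_xx + d_y h_xy > 0 together with m > 0, and the hypothesis on the second
derivatives of h supplies such a d (`exists_direction`).

The rest is transport between ℝ² × (ℝ²)* and T*Q: every chart of Q induces canonical coordinates
(`canonicalSymplectic_apply`), so X_H obeys Hamilton's equations in the adapted chart, and the
coordinate version of Lyapunov's theorem (`lyapunov_stable`) carries over (`isStableAt_of_coord`).
-/

namespace LCB

/-! ### Smooth dependence of integrals on parameters. -/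

section ParametricIntegral

variable {E G : Type} [NormedAddCommGroup E] [NormedSpace ℝ E] [ProperSpace E]
  [NormedAddCommGroup G] [NormedSpace ℝ G]

theorem hasFDerivAt_integral_of_contDiff [CompleteSpace G] {F : E × ℝ → G}
    (hF : ContDiff ℝ 1 F) (x₀ : E) :
    HasFDerivAt (fun x => ∫ r in (0 : ℝ)..1, F (x, r))
      (∫ r in (0 : ℝ)..1, (fderiv ℝ F (x₀, r)).comp (ContinuousLinearMap.inl ℝ E ℝ)) x₀ := by
  have hF' : Continuous fun z : E × ℝ => (fderiv ℝ F z).comp (ContinuousLinearMap.inl ℝ E ℝ) :=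
    (hF.continuous_fderiv one_ne_zero).clm_comp continuous_const
  -- Compactness of the ball times [0, 1] gives a constant that dominates the derivative.
  obtain ⟨C, hC⟩ := ((isCompact_closedBall x₀ (1 : ℝ)).prod
    (isCompact_Icc (a := (0 : ℝ)) (b := 1))).exists_bound_of_continuousOn hF'.continuousOn
  refine intervalIntegral.hasFDerivAt_integral_of_dominated_of_fderiv_le
    (F := fun x r => F (x, r))
    (F' := fun x r => (fderiv ℝ F (x, r)).comp (ContinuousLinearMap.inl ℝ E ℝ))
    (bound := fun _ => C) (Metric.ball_mem_nhds x₀ one_pos) ?_ ?_ ?_ ?_ ?_ ?_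
  · exact Eventually.of_forall fun x =>
      (hF.continuous.comp (by fun_prop : Continuous fun r : ℝ => (x, r))).aestronglyMeasurable
  · exact (hF.continuous.comp
      (by fun_prop : Continuous fun r : ℝ => (x₀, r))).intervalIntegrable _ _
  · exact (hF'.comp (by fun_prop : Continuous fun r : ℝ => (x₀, r))).aestronglyMeasurable
  · refine Eventually.of_forall fun r hr x hx => hC (x, r) ⟨Metric.ball_subset_closedBall hx, ?_⟩
    rw [uIoc_of_le zero_le_one] at hr
    exact Ioc_subset_Icc_self hr
  · exact intervalIntegrable_const
  · refine Eventually.of_forall fun r _ x _ => ?_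
    exact ((hF.differentiable one_ne_zero) (x, r)).hasFDerivAt.comp x (hasFDerivAt_prodMk_left x r)

/-- The derivative is again an integral of this kind, with values in a space of linear maps. The
target space therefore has to vary inside the induction on the order. -/
theorem contDiff_nat_integral (n : ℕ) : ∀ {G : Type} [NormedAddCommGroup G] [NormedSpace ℝ G]
    [CompleteSpace G] {F : E × ℝ → G}, ContDiff ℝ ∞ F →
      ContDiff ℝ n (fun x => ∫ r in (0 : ℝ)..1, F (x, r)) := by
  induction n with
  | zero =>
    intro G _ _ _ F hF
    refine contDiff_zero.2 (continuous_iff_continuousAt.2 fun x => ?_)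
    exact (hasFDerivAt_integral_of_contDiff (hF.of_le (by exact_mod_cast le_top)) x).continuousAt
  | succ n ih =>
    intro G _ _ _ F hF
    have hF1 : ContDiff ℝ 1 F := hF.of_le (by exact_mod_cast le_top)
    push_cast
    rw [contDiff_succ_iff_hasFDerivAt]
    refine ⟨fun x => ∫ r in (0 : ℝ)..1, (fderiv ℝ F (x, r)).comp
      (ContinuousLinearMap.inl ℝ E ℝ), ?_, fun x => hasFDerivAt_integral_of_contDiff hF1 x⟩
    exact ih (F := fun z => (fderiv ℝ F z).comp (ContinuousLinearMap.inl ℝ E ℝ))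
      ((hF.fderiv_right (by simp)).clm_comp contDiff_const)

/-- An integral over `[0, 1]` depends smoothly on the parameters of its integrand. -/
theorem contDiff_integral [CompleteSpace G] {F : E × ℝ → G} (hF : ContDiff ℝ ∞ F) :
    ContDiff ℝ ∞ (fun x => ∫ r in (0 : ℝ)..1, F (x, r)) :=
  contDiff_infty.2 fun n => contDiff_nat_integral n hF

end ParametricIntegral

/-! ### Antiderivatives along parallel lines, and cut-offs. -/

section Antiderivative

variable {E : Type} [NormedAddCommGroup E] [NormedSpace ℝ E]

/-- The antiderivative of `F` in the direction `d` that vanishes on the kernel of `t`. -/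
noncomputable def lineIntegral (d : E) (t : E →L[ℝ] ℝ) (F : E → ℝ) (q : E) : ℝ :=
  t q * ∫ r in (0 : ℝ)..1, F (q + ((r - 1) * t q) • d)

theorem contDiff_lineIntegral [ProperSpace E] (d : E) (t : E →L[ℝ] ℝ) {F : E → ℝ}
    (hF : ContDiff ℝ ∞ F) : ContDiff ℝ ∞ (lineIntegral d t F) := by
  refine t.contDiff.mul (contDiff_integral
    (F := fun z : E × ℝ => F (z.1 + ((z.2 - 1) * t z.1) • d)) (hF.comp ?_))
  fun_prop

/-- Substitution s = r · t q. Fixed limits show smoothness in q; a moving upper limit shows the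
derivative along d. -/
theorem lineIntegral_eq (d : E) (t : E →L[ℝ] ℝ) (F : E → ℝ) (q : E) :
    lineIntegral d t F q = ∫ s in (0 : ℝ)..t q, F (q + (s - t q) • d) := by
  have := intervalIntegral.mul_integral_comp_mul_left
    (f := fun s => F (q + (s - t q) • d)) (t q) (a := 0) (b := 1)
  simp only [mul_zero, mul_one] at this
  rw [← this, lineIntegral]
  congr 1
  refine intervalIntegral.integral_congr fun r _ => ?_
  show F _ = F _
  congr 3
  ring

/-- Moving q to q + τd leaves the line of integration unchanged and only shifts the upper limit by
τ, so this is the fundamental theorem of calculus. -/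
theorem fderiv_lineIntegral [ProperSpace E] {d : E} {t : E →L[ℝ] ℝ} (ht : t d = 1) {F : E → ℝ}
    (hF : ContDiff ℝ ∞ F) (q : E) : fderiv ℝ (lineIntegral d t F) q d = F q := by
  have hd : HasDerivAt (fun τ : ℝ => lineIntegral d t F (q + τ • d))
      (fderiv ℝ (lineIntegral d t F) q d) 0 := by
    have h1 : HasFDerivAt (lineIntegral d t F) (fderiv ℝ (lineIntegral d t F) q)
        (q + (0 : ℝ) • d) := by
      rw [zero_smul, add_zero]
      exact ((contDiff_lineIntegral d t hF).differentiable (by simp) q).hasFDerivAt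
    have h2 : HasDerivAt (fun τ : ℝ => q + τ • d) d 0 := by
      simpa using ((hasDerivAt_id (0 : ℝ)).smul_const d).const_add q
    exact h1.comp_hasDerivAt 0 h2
  have hG : Continuous fun s : ℝ => F (q + (s - t q) • d) :=
    hF.continuous.comp (by fun_prop)
  have hd' : HasDerivAt (fun τ : ℝ => lineIntegral d t F (q + τ • d)) (F q) 0 := by
    have h3 : (fun τ : ℝ => lineIntegral d t F (q + τ • d)) =
        fun τ => ∫ s in (0 : ℝ)..(t q + τ), F (q + (s - t q) • d) := by
      funext τ
      rw [lineIntegral_eq]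
      have : t (q + τ • d) = t q + τ := by simp [ht]
      rw [this]
      refine intervalIntegral.integral_congr fun s _ => ?_
      show F _ = F _
      congr 1
      module
    rw [h3]
    have h4 := intervalIntegral.integral_hasDerivAt_right (hG.intervalIntegrable 0 (t q + 0))
      (hG.stronglyMeasurableAtFilter _ _) hG.continuousAt
    have h5 := h4.comp_const_add (t q) 0
    simpa using h5
  exact hd.unique hd'

theorem lineIntegral_zero (d : E) (t : E →L[ℝ] ℝ) (F : E → ℝ) : lineIntegral d t F 0 = 0 := by
  simp [lineIntegral]

/-- If `F` vanishes at the origin and increases there in the direction `d`, then its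
antiderivative in the direction `d` becomes positive definite near the origin after adding
a large multiple of the squared transversal distance. -/
theorem exists_lineIntegral_pos {d : E} {t : E →L[ℝ] ℝ} {F : E → ℝ}
    (hF : Continuous F) (hF' : DifferentiableAt ℝ F 0) (hF0 : F 0 = 0)
    (hd : 0 < fderiv ℝ F 0 d) :
    ∃ k : ℝ, ∀ᶠ q in 𝓝 (0 : E), q ≠ 0 → 0 < lineIntegral d t F q + k * ‖q - t q • d‖ ^ 2 := by
  set l := fderiv ℝ F 0 d with hl
  set C := ‖fderiv ℝ F 0‖ + l with hC
  have hC0 : 0 < C := by positivity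
  -- The first bound gives ε‖d‖ ≤ l/2, so the longitudinal error costs at most half the slope; the
  -- second makes the transversal error at most Cρ.
  have hε : 0 < min (l / (2 * (‖d‖ + 1))) l := by positivity
  set ε := min (l / (2 * (‖d‖ + 1))) l with hεdef
  have hεd : ε * ‖d‖ ≤ l / 2 := by
    have h1 : ε ≤ l / (2 * (‖d‖ + 1)) := min_le_left _ _
    rw [le_div_iff₀ (by positivity)] at h1
    nlinarith [norm_nonneg d]
  have hεl : ε ≤ l := min_le_right _ _
  -- The term 2C²/l completes the square with the cross term Cρ|s|; the extra 1 gives strict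
  -- positivity when s = 0.
  refine ⟨2 * C ^ 2 / l + 1, ?_⟩
  have h0 := (hasFDerivAt_iff_isLittleO_nhds_zero.1 hF'.hasFDerivAt).def hε
  simp only [zero_add, hF0, sub_zero] at h0
  obtain ⟨δ, hδ, hball⟩ := Metric.eventually_nhds_iff_ball.1 h0
  have hcont : Continuous fun q : E => |t q| * ‖d‖ + ‖q - t q • d‖ := by fun_prop
  have hev : ∀ᶠ q in 𝓝 (0 : E), |t q| * ‖d‖ + ‖q - t q • d‖ < δ :=
    hcont.continuousAt.eventually_lt continuousAt_const (by simpa using hδ)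
  filter_upwards [hev] with q hq hq0
  set s := t q with hs
  set ρ := ‖q - s • d‖ with hρ
  have hρ0 : 0 ≤ ρ := norm_nonneg _
  -- At z = r s d + (q - s d) the linear approximation of F is r s l up to a transversal error, so s
  -- F(z) grows at least like half of l s² r.
  have hpt : ∀ r ∈ Ioc (0 : ℝ) 1,
      l / 2 * s ^ 2 * r - C * ρ * |s| ≤ s * F (q + ((r - 1) * s) • d) := by
    intro r hr
    have hr0 := hr.1
    have hr1 := hr.2
    set z := q + ((r - 1) * s) • d with hz
    have hzdec : z = (r * s) • d + (q - s • d) := by rw [hz]; module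
    have hzn : ‖z‖ ≤ r * |s| * ‖d‖ + ρ := by
      rw [hzdec]
      refine (norm_add_le _ _).trans ?_
      rw [norm_smul, Real.norm_eq_abs, abs_mul, abs_of_pos hr0]
    have hsd : 0 ≤ |s| * ‖d‖ := by positivity
    have hzδ : z ∈ Metric.ball (0 : E) δ := by
      rw [mem_ball_zero_iff]
      nlinarith
    have h1 := hball z hzδ
    have h2 : fderiv ℝ F 0 z = r * s * l + fderiv ℝ F 0 (q - s • d) := by
      rw [hzdec, map_add, map_smul, smul_eq_mul]
    have h3 : |fderiv ℝ F 0 (q - s • d)| ≤ ‖fderiv ℝ F 0‖ * ρ :=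
      (fderiv ℝ F 0).le_opNorm _
    rw [Real.norm_eq_abs] at h1
    have h4 : |F z - r * s * l| ≤ ε * (r * |s| * ‖d‖ + ρ) + ‖fderiv ℝ F 0‖ * ρ := by
      have : F z - r * s * l = (F z - fderiv ℝ F 0 z) + fderiv ℝ F 0 (q - s • d) := by
        rw [h2]; ring
      rw [this]
      refine (abs_add_le _ _).trans (add_le_add (h1.trans ?_) h3)
      gcongr
    have h5 : |F z - r * s * l| ≤ l / 2 * (r * |s|) + C * ρ := by
      refine h4.trans ?_
      have : ε * ρ ≤ l * ρ := by gcongr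
      have h6 : (ε * ‖d‖) * (r * |s|) ≤ l / 2 * (r * |s|) := by gcongr
      rw [hC]
      nlinarith
    have h7 : -(|s| * (l / 2 * (r * |s|) + C * ρ)) ≤ s * (F z - r * s * l) := by
      have h8 := neg_abs_le (s * (F z - r * s * l))
      rw [abs_mul] at h8
      have : |s| * |F z - r * s * l| ≤ |s| * (l / 2 * (r * |s|) + C * ρ) := by gcongr
      linarith
    have h9 : |s| * (l / 2 * (r * |s|) + C * ρ) = l / 2 * s ^ 2 * r + C * ρ * |s| := by
      rw [← sq_abs s]
      ring
    rw [h9] at h7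
    linarith
  have hint : l / 4 * s ^ 2 - C * ρ * |s| ≤ lineIntegral d t F q := by
    have h1 : ∫ r in (0 : ℝ)..1, (l / 2 * s ^ 2 * r - C * ρ * |s|) =
        l / 4 * s ^ 2 - C * ρ * |s| := by
      rw [intervalIntegral.integral_sub
          (Continuous.intervalIntegrable (by fun_prop) _ _) intervalIntegrable_const,
        intervalIntegral.integral_const_mul, integral_id]
      simp
      ring
    rw [← h1, lineIntegral, ← intervalIntegral.integral_const_mul]
    refine intervalIntegral.integral_mono_on_of_le_Ioo zero_le_one
      (Continuous.intervalIntegrable (by fun_prop) _ _)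
      (Continuous.intervalIntegrable (by fun_prop) _ _) fun r hr => hpt r ⟨hr.1, hr.2.le⟩
  have hkey : 0 ≤ l / 8 * s ^ 2 - C * ρ * |s| + 2 * C ^ 2 / l * ρ ^ 2 := by
    have : l / 8 * s ^ 2 - C * ρ * |s| + 2 * C ^ 2 / l * ρ ^ 2 =
        l / 8 * (|s| - 4 * C / l * ρ) ^ 2 := by
      rw [← sq_abs s]
      field_simp
      ring
    rw [this]
    positivity
  have hpos : 0 < l / 8 * s ^ 2 + ρ ^ 2 := by
    by_cases hs0 : s = 0
    · have : ρ ≠ 0 := by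
        rw [hρ, hs0, zero_smul, sub_zero]
        exact norm_ne_zero_iff.2 hq0
      positivity
    · positivity
  nlinarith

end Antiderivative

/-- A function that is smooth near a point agrees near that point with a compactly supported
smooth function. -/
theorem exists_contDiff_eventuallyEq {E : Type} [NormedAddCommGroup E] [NormedSpace ℝ E]
    [FiniteDimensional ℝ E] {G : Type} [NormedAddCommGroup G] [NormedSpace ℝ G]
    {Ω : Set E} (hΩ : IsOpen Ω) {x₀ : E} (h0 : x₀ ∈ Ω) {F : E → G} (hF : ContDiffOn ℝ ∞ F Ω) :
    ∃ F' : E → G, ContDiff ℝ ∞ F' ∧ HasCompactSupport F' ∧ F' =ᶠ[𝓝 x₀] F := by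
  obtain ⟨δ, hδ, hball⟩ := Metric.nhds_basis_closedBall.mem_iff.1 (hΩ.mem_nhds h0)
  let χ : ContDiffBump x₀ := ⟨δ / 2, δ, by positivity, by linarith⟩
  refine ⟨fun x => χ x • F x, ?_, ?_, ?_⟩
  · refine contDiff_iff_contDiffAt.2 fun x => ?_
    by_cases hx : x ∈ tsupport χ
    -- The support of the bump function lies in Ω, so the product is smooth there and vanishes near
    -- every other point.
    · have hxΩ : x ∈ Ω := hball (by rwa [χ.tsupport_eq] at hx)
      exact χ.contDiff.contDiffAt.smul (hF.contDiffAt (hΩ.mem_nhds hxΩ))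
    · refine (contDiffAt_const (c := (0 : G))).congr_of_eventuallyEq ?_
      filter_upwards [notMem_tsupport_iff_eventuallyEq.1 hx] with y hy
      simp [hy]
  · exact χ.hasCompactSupport.smul_right
  · filter_upwards [Metric.closedBall_mem_nhds x₀ χ.rIn_pos] with x hx
    simp [χ.one_of_mem_closedBall hx]

end LCB

namespace LCB

/-! ### Lyapunov's theorem in a finite-dimensional space. -/

section Lyapunov

variable {E : Type} [NormedAddCommGroup E] [NormedSpace ℝ E]

/-- A compactly supported smooth vector field on a finite-dimensional space is complete. -/
theorem exists_global_integralCurve [FiniteDimensional ℝ E] {X : E → E}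
    (hX : ContDiff ℝ ∞ X) (hc : HasCompactSupport X)
    (x : E) : ∃ γ : ℝ → E, γ 0 = x ∧ ∀ t, HasDerivAt γ (X (γ t)) t := by
  have hX1 : ContDiff ℝ 1 X := hX.of_le (by exact_mod_cast le_top)
  obtain ⟨K, hK⟩ := hX1.lipschitzWith_of_hasCompactSupport hc one_ne_zero
  obtain ⟨L, hL⟩ := hc.exists_bound_of_continuous hX.continuous
  have hL0 : 0 ≤ L := (norm_nonneg _).trans (hL x)
  have hcurve : ∃ γ, γ 0 = x ∧ IsMIntegralCurve (I := 𝓘(ℝ, E)) γ X := by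
    refine exists_isMIntegralCurve_of_isMIntegralCurveOn (ε := 1) ?_ one_pos ?_ x
    · exact contMDiff_vectorSpace_iff_contDiff.2 hX1
    · intro y
      -- The field is globally Lipschitz and bounded by L, so the ball of radius L around any
      -- starting point contains the solution for time 1. A uniform existence time implies
      -- completeness.
      have hPL : IsPicardLindelof (fun _ : ℝ => X) (tmin := -1) (tmax := 1)
          ⟨0, by norm_num, by norm_num⟩ y L.toNNReal 0 L.toNNReal K :=
        { lipschitzOnWith := fun _ _ => hK.lipschitzOnWith
          continuousOn := fun _ _ => continuousOn_const
          norm_le := fun _ _ z _ => by simpa [Real.coe_toNNReal _ hL0] using hL z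
          mul_max_le := by simp }
      obtain ⟨γ, h0, hγ⟩ := hPL.exists_eq_forall_mem_Icc_hasDerivWithinAt₀
      refine ⟨γ, h0, fun t ht => ?_⟩
      exact (((hγ t (Ioo_subset_Icc_self ht)).hasDerivAt
        (Icc_mem_nhds ht.1 ht.2)).hasFDerivAt.hasMFDerivAt).hasMFDerivWithinAt
  obtain ⟨γ, h0, hγ⟩ := hcurve
  refine ⟨γ, h0, fun t => ?_⟩
  have h1 : HasFDerivAt γ ((1 : ℝ →L[ℝ] ℝ).smulRight (X (γ t))) t :=
    hasMFDerivAt_iff_hasFDerivAt.1 (hγ t)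
  simpa using h1.hasDerivAt

/-- A curve along which a function decreases inside a ball cannot leave that ball if the function
starts below its values on the bounding sphere. -/
theorem mem_ball_of_barrier {X : E → E} {V : E → ℝ} {D : Set E} (hD : IsOpen D)
    (hV : DifferentiableOn ℝ V D)
    (hdec : ∀ z ∈ D, fderiv ℝ V z (X z) ≤ 0) {r m : ℝ} (hball : Metric.closedBall 0 r ⊆ D)
    (hm : ∀ z ∈ Metric.sphere (0 : E) r, m ≤ V z)
    {γ : ℝ → E} {S : Set ℝ} {T : ℝ} (hT : 0 ≤ T) (hS : Icc 0 T ⊆ S)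
    (hγc : ContinuousOn γ S)
    (hγ : ∀ t ∈ S, γ t ∈ Metric.ball (0 : E) r → HasDerivWithinAt γ (X (γ t)) S t)
    (h0 : γ 0 ∈ Metric.ball (0 : E) r) (h0m : V (γ 0) < m) :
    γ T ∈ Metric.ball (0 : E) r := by
  by_contra hT'
  have hcn : ContinuousOn (fun t => ‖γ t‖) (Icc 0 T) := (hγc.mono hS).norm
  have hcomp : IsCompact (Icc 0 T ∩ (fun t => ‖γ t‖) ⁻¹' Ici r) :=
    isCompact_Icc.of_isClosed_subset (hcn.preimage_isClosed_of_isClosed isClosed_Icc isClosed_Ici)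
      inter_subset_left
  -- `t₁` is the first exit time. The norm equals r there by continuity, while V has not increased
  -- from a value below m.
  obtain ⟨t₁, ⟨ht₁, hr₁⟩, hleast⟩ := hcomp.exists_isLeast
    ⟨T, ⟨hT, le_rfl⟩, by simpa using hT'⟩
  rw [mem_ball_zero_iff] at h0
  have hlt : ∀ t ∈ Ico 0 t₁, ‖γ t‖ < r := fun t ht => by
    by_contra hcon
    exact absurd (hleast ⟨⟨ht.1, ht.2.le.trans ht₁.2⟩, not_lt.1 hcon⟩) (not_le.2 ht.2)
  have ht₁0 : 0 < t₁ := by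
    rcases ht₁.1.eq_or_lt with h | h
    · rw [← h] at hr₁
      exact absurd h0 (not_lt.2 hr₁)
    · exact h
  have hsub : Icc 0 t₁ ⊆ Icc 0 T := Icc_subset_Icc_right ht₁.2
  have hle : ‖γ t₁‖ ≤ r := by
    have hcl : t₁ ∈ closure (Ico 0 t₁) := by
      rw [closure_Ico ht₁0.ne]
      exact ⟨ht₁0.le, le_rfl⟩
    have := (hcn.mono hsub t₁ ⟨ht₁0.le, le_rfl⟩).mono Ico_subset_Icc_self
    exact this.closure_le hcl continuousWithinAt_const fun t ht => (hlt t ht).le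
  have hmem : ∀ t ∈ Icc 0 t₁, γ t ∈ D := fun t ht => hball <| by
    rw [mem_closedBall_zero_iff]
    rcases ht.2.eq_or_lt with h | h
    · rw [h]; exact hle
    · exact (hlt t ⟨ht.1, h⟩).le
  have hanti : AntitoneOn (fun t => V (γ t)) (Icc 0 t₁) := by
    refine antitoneOn_of_hasDerivWithinAt_nonpos (f' := fun t => fderiv ℝ V (γ t) (X (γ t)))
      (convex_Icc _ _) ?_ ?_ ?_
    · exact hV.continuousOn.comp (hγc.mono (hsub.trans hS)) hmem
    · intro t ht
      rw [interior_Icc] at ht ⊢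
      have ht' : t ∈ Icc 0 t₁ := Ioo_subset_Icc_self ht
      have h1 := (hV.differentiableAt (hD.mem_nhds (hmem t ht'))).hasFDerivAt
      have h2 := (hγ t (hS (hsub ht')) (by
        rw [mem_ball_zero_iff]; exact hlt t ⟨ht.1.le, ht.2⟩)).mono
          (Ioo_subset_Icc_self.trans (hsub.trans hS))
      exact h1.comp_hasDerivWithinAt t h2
    · intro t ht
      rw [interior_Icc] at ht
      exact hdec _ (hmem t (Ioo_subset_Icc_self ht))
  have h1 := hanti ⟨le_rfl, ht₁0.le⟩ ⟨ht₁0.le, le_rfl⟩ ht₁0.le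
  have h2 := hm (γ t₁) (by rw [mem_sphere_zero_iff_norm]; exact le_antisymm hle hr₁)
  exact absurd (h2.trans h1) (not_le.2 h0m)

/-- Lyapunov's stability theorem on an open subset of a finite-dimensional space. -/
theorem lyapunov_stable [FiniteDimensional ℝ E] {X : E → E} {V : E → ℝ} {D : Set E}
    (hD : IsOpen D) (h0D : (0 : E) ∈ D)
    (hX : ContDiffOn ℝ ∞ X D) (hV : DifferentiableOn ℝ V D) (hV0 : V 0 = 0)
    (hpos : ∀ z ∈ D, z ≠ 0 → 0 < V z) (hdec : ∀ z ∈ D, fderiv ℝ V z (X z) ≤ 0)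
    {N : Set E} (hN : N ∈ 𝓝 (0 : E)) :
    ∃ N' ∈ 𝓝 (0 : E), ∀ z ∈ N',
      (∃ γ : ℝ → E, γ 0 = z ∧ ∀ t ∈ Ici (0 : ℝ), γ t ∈ D ∧ HasDerivAt γ (X (γ t)) t) ∧
      (∀ (γ : ℝ → E) (τ : ℝ), γ 0 = z →
        (∀ t ∈ Ico 0 τ, HasDerivWithinAt γ (X (γ t)) (Ico 0 τ) t) → ∀ t ∈ Ico 0 τ, γ t ∈ N) := by
  -- A complete field that agrees with X near 0 supplies trajectories for all times. They never
  -- leave the ball of agreement, so they are trajectories of X.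
  obtain ⟨X', hX', hX'c, heq⟩ := exists_contDiff_eventuallyEq hD h0D hX
  obtain ⟨r, hr, hsub⟩ := Metric.nhds_basis_closedBall.mem_iff.1
    (inter_mem (inter_mem hN (hD.mem_nhds h0D)) heq)
  have hrD : Metric.closedBall (0 : E) r ⊆ D := fun z hz => (hsub hz).1.2
  obtain ⟨m, hm0, hm⟩ : ∃ m : ℝ, 0 < m ∧ ∀ z ∈ Metric.sphere (0 : E) r, m ≤ V z := by
    -- The sphere is empty when the space is trivial; any positive m then serves.
    rcases (Metric.sphere (0 : E) r).eq_empty_or_nonempty with h | h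
    · exact ⟨1, one_pos, by simp [h]⟩
    · obtain ⟨z, hz, hmin⟩ := (isCompact_sphere (0 : E) r).exists_isMinOn h
        (hV.continuousOn.mono (Metric.sphere_subset_closedBall.trans hrD))
      refine ⟨V z, hpos z (hrD (Metric.sphere_subset_closedBall hz)) ?_, fun y hy => hmin hy⟩
      rintro rfl
      simp at hz
      exact hr.ne hz
  refine ⟨Metric.ball 0 r ∩ {z | V z < m}, inter_mem (Metric.ball_mem_nhds _ hr) ?_, ?_⟩
  · have hc : ContinuousAt V 0 := (hV.differentiableAt (hD.mem_nhds h0D)).continuousAt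
    exact hc.eventually_lt continuousAt_const (by rwa [hV0])
  rintro z ⟨hzr, hzm⟩
  constructor
  · obtain ⟨γ, hγ0, hγ⟩ := exists_global_integralCurve hX' hX'c z
    have hstay : ∀ t ∈ Ici (0 : ℝ), γ t ∈ Metric.ball (0 : E) r := by
      intro t ht
      -- The barrier lemma asks for the equation of X only inside the ball, which is all that is
      -- known here.
      refine mem_ball_of_barrier (S := univ) (X := X) (V := V) (m := m) hD hV hdec hrD hm ht
        (subset_univ _) (fun s _ => (hγ s).continuousAt.continuousWithinAt) ?_
        (by rwa [hγ0]) (by rwa [hγ0])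
      intro s _ hs
      have := hγ s
      rw [show X' (γ s) = X (γ s) from (hsub (Metric.ball_subset_closedBall hs)).2] at this
      exact this.hasDerivWithinAt
    refine ⟨γ, hγ0, fun t ht => ?_⟩
    have hb := Metric.ball_subset_closedBall (hstay t ht)
    refine ⟨hrD hb, ?_⟩
    rw [← show X' (γ t) = X (γ t) from (hsub hb).2]
    exact hγ t
  · intro γ τ hγ0 hγ t ht
    have : γ t ∈ Metric.ball (0 : E) r :=
      mem_ball_of_barrier (S := Ico 0 τ) hD hV hdec hrD hm ht.1
        (fun s hs => ⟨hs.1, hs.2.trans_lt ht.2⟩) (fun s hs => (hγ s hs).continuousWithinAt)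
        (fun s hs _ => hγ s hs) (by rwa [hγ0]) (by rwa [hγ0])
    exact (hsub (Metric.ball_subset_closedBall this)).1.1

end Lyapunov

end LCB

namespace LCB

/-! ### Charts of Q and the coordinates they induce on T*Q. -/

section CotangentChart

variable {Q : Type*} [TopologicalSpace Q] [ChartedSpace E2 Q] {φ : OpenPartialHomeomorph Q E2}

theorem contMDiffAt_chart (hφ : φ ∈ IsManifold.maximalAtlas (𝓡 2) ∞ Q) {q : Q}
    (hq : q ∈ φ.source) : ContMDiffAt (𝓡 2) 𝓘(ℝ, E2) ∞ φ q :=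
  contMDiffAt_of_mem_maximalAtlas hφ hq

theorem contMDiffAt_chart_symm (hφ : φ ∈ IsManifold.maximalAtlas (𝓡 2) ∞ Q) {z : E2}
    (hz : z ∈ φ.target) : ContMDiffAt 𝓘(ℝ, E2) (𝓡 2) ∞ φ.symm z :=
  contMDiffAt_symm_of_mem_maximalAtlas hφ hz

theorem mdifferentiable_chart (hφ : φ ∈ IsManifold.maximalAtlas (𝓡 2) ∞ Q) :
    φ.MDifferentiable (𝓡 2) 𝓘(ℝ, E2) :=
  ⟨fun _ hq => ((contMDiffAt_chart hφ hq).mdifferentiableAt (by simp)).mdifferentiableWithinAt,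
    fun _ hz => ((contMDiffAt_chart_symm hφ hz).mdifferentiableAt
      (by simp)).mdifferentiableWithinAt⟩

theorem contDiffAt_transition {ψ : OpenPartialHomeomorph Q E2}
    (hφ : φ ∈ IsManifold.maximalAtlas (𝓡 2) ∞ Q) (hψ : ψ ∈ IsManifold.maximalAtlas (𝓡 2) ∞ Q)
    {z : E2} (hz : z ∈ ψ.target) (hz' : ψ.symm z ∈ φ.source) :
    ContDiffAt ℝ ∞ (φ ∘ ψ.symm) z :=
  contMDiffAt_iff_contDiffAt.1
    ((contMDiffAt_chart hφ hz').comp z (contMDiffAt_chart_symm hψ hz))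

theorem isInvertible_chartDeriv (hφ : φ ∈ IsManifold.maximalAtlas (𝓡 2) ∞ Q) {q : Q}
    (hq : q ∈ φ.source) : (chartDeriv φ q).IsInvertible :=
  ⟨(mdifferentiable_chart hφ).mfderiv hq, rfl⟩

/-- Differentials of two charts differ by the derivative of the transition map. -/
theorem fderiv_transition_comp {ψ : OpenPartialHomeomorph Q E2}
    (hφ : φ ∈ IsManifold.maximalAtlas (𝓡 2) ∞ Q) (hψ : ψ ∈ IsManifold.maximalAtlas (𝓡 2) ∞ Q)
    {q : Q} (hq : q ∈ φ.source) (hq' : q ∈ ψ.source) :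
    (fderiv ℝ (φ ∘ ψ.symm) (ψ q)).comp (chartDeriv ψ q) = chartDeriv φ q := by
  have h1 : MDifferentiableAt 𝓘(ℝ, E2) 𝓘(ℝ, E2) (φ ∘ ψ.symm) (ψ q) :=
    ((contDiffAt_transition hφ hψ (ψ.map_source hq') (by rwa [ψ.left_inv hq'])).differentiableAt
      (by simp)).mdifferentiableAt
  have h2 : MDifferentiableAt (𝓡 2) 𝓘(ℝ, E2) ψ q :=
    (contMDiffAt_chart hψ hq').mdifferentiableAt (by simp)
  have h3 := mfderiv_comp q h1 h2
  rw [mfderiv_eq_fderiv] at h3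
  have h4 : ((φ ∘ ψ.symm) ∘ ψ) =ᶠ[𝓝 q] φ := by
    filter_upwards [ψ.open_source.mem_nhds hq'] with x hx
    simp [ψ.left_inv hx]
  exact h3.symm.trans h4.mfderiv_eq

/-- The inverse of the coordinates `cotangentCoord φ`. -/
noncomputable def cotangentLift (φ : OpenPartialHomeomorph Q E2) (z : E2 × E2Dual) :
    CotangentBundle Q :=
  ⟨φ.symm z.1, z.2.comp (chartDeriv φ (φ.symm z.1))⟩

theorem cotangentCoord_lift (hφ : φ ∈ IsManifold.maximalAtlas (𝓡 2) ∞ Q) {z : E2 × E2Dual}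
    (hz : z.1 ∈ φ.target) : cotangentCoord φ (cotangentLift φ z) = z := by
  refine Prod.ext (φ.right_inv hz) ?_
  have h := isInvertible_chartDeriv hφ (φ.map_target hz)
  show (z.2.comp (chartDeriv φ (φ.symm z.1))).comp (chartDeriv φ (φ.symm z.1)).inverse = z.2
  rw [ContinuousLinearMap.comp_assoc, h.self_comp_inverse]
  rfl

theorem cotangentLift_coord (hφ : φ ∈ IsManifold.maximalAtlas (𝓡 2) ∞ Q) {α : CotangentBundle Q}
    (hα : α.proj ∈ φ.source) : cotangentLift φ (cotangentCoord φ α) = α := by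
  obtain ⟨q, p⟩ := α
  have h := isInvertible_chartDeriv hφ hα
  show (⟨φ.symm (φ q), (p.comp (chartDeriv φ q).inverse).comp (chartDeriv φ (φ.symm (φ q)))⟩ :
    CotangentBundle Q) = ⟨q, p⟩
  rw [φ.left_inv hα, ContinuousLinearMap.comp_assoc, h.inverse_comp_self]
  rfl

theorem cotangentCoord_nullPoint {q₀ : Q} (hφ0 : φ q₀ = 0) :
    cotangentCoord φ (nullPoint q₀) = 0 := by
  refine Prod.ext hφ0 ?_
  ext v
  rfl

variable [IsManifold (𝓡 2) ∞ Q]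

theorem chartAt_mem (q : Q) : chartAt E2 q ∈ IsManifold.maximalAtlas (𝓡 2) ∞ Q :=
  IsManifold.chart_mem_maximalAtlas q

theorem chartDeriv_chartAt {q q₁ : Q} (hq₁ : q ∈ (chartAt E2 q₁).source) :
    chartDeriv (chartAt E2 q₁) q =
      (trivializationAt E2 (TangentSpace (𝓡 2)) q₁).continuousLinearMapAt ℝ q :=
  (TangentBundle.continuousLinearMapAt_trivializationAt (I := 𝓡 2) hq₁).symm

theorem symmL_chartDeriv {q q₁ : Q} (hq₁ : q ∈ (chartAt E2 q₁).source)
    (u : TangentSpace (𝓡 2) q) :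
    (trivializationAt E2 (TangentSpace (𝓡 2)) q₁).symmL ℝ q
      (chartDeriv (chartAt E2 q₁) q u) = u := by
  rw [chartDeriv_chartAt hq₁]
  exact (trivializationAt E2 (TangentSpace (𝓡 2)) q₁).symmL_continuousLinearMapAt
    (R := ℝ) (b := q) (by simpa using hq₁) u

/-- The bridge from the bundle structure to calculus: trivializations of the tangent bundle are read
through transition maps, whose derivatives are smooth. -/
theorem chartDeriv_comp_symmL (hφ : φ ∈ IsManifold.maximalAtlas (𝓡 2) ∞ Q) {q q₁ : Q}
    (hq : q ∈ φ.source) (hq₁ : q ∈ (chartAt E2 q₁).source) :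
    (chartDeriv φ q).comp ((trivializationAt E2 (TangentSpace (𝓡 2)) q₁).symmL ℝ q) =
      fderiv ℝ (φ ∘ (chartAt E2 q₁).symm) (chartAt E2 q₁ q) := by
  rw [← fderiv_transition_comp hφ (chartAt_mem q₁) hq hq₁, chartDeriv_chartAt hq₁]
  ext v : 1
  have h2 := (trivializationAt E2 (TangentSpace (𝓡 2)) q₁).continuousLinearMapAt_symmL
    (R := ℝ) (b := q) (by simpa using hq₁) v
  exact congrArg _ h2

theorem hom_coordinates (q₁ : Q) (α : CotangentBundle Q) :
    ContinuousLinearMap.inCoordinates E2 (TangentSpace (𝓡 2)) ℝ (Bundle.Trivial Q ℝ)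
      q₁ α.proj q₁ α.proj α.snd =
    α.snd.comp ((trivializationAt E2 (TangentSpace (𝓡 2)) q₁).symmL ℝ α.proj) := by
  ext v
  simp [ContinuousLinearMap.inCoordinates]

/-- In the trivialization given by the preferred chart ψ, the covector part is p composed with the
derivative of φ ∘ ψ⁻¹, hence smooth in base point and momentum. -/
theorem contMDiffAt_cotangentLift (hφ : φ ∈ IsManifold.maximalAtlas (𝓡 2) ∞ Q) {z : E2 × E2Dual}
    (hz : z.1 ∈ φ.target) :
    ContMDiffAt 𝓘(ℝ, E2 × E2Dual) cotModel ∞ (cotangentLift φ : _ → CotangentBundle Q) z := by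
  have hfst : ContMDiffAt 𝓘(ℝ, E2 × E2Dual) 𝓘(ℝ, E2) ∞ (Prod.fst : E2 × E2Dual → E2) z :=
    contDiff_fst.contMDiff.contMDiffAt
  have hbase : ContMDiffAt 𝓘(ℝ, E2 × E2Dual) (𝓡 2) ∞ (fun w : E2 × E2Dual => φ.symm w.1) z :=
    (contMDiffAt_chart_symm hφ hz).comp z hfst
  refine (contMDiffAt_hom_bundle (cotangentLift φ : _ → CotangentBundle Q)).2 ⟨hbase, ?_⟩
  set q₁ := φ.symm z.1 with hq₁
  set ψ := chartAt E2 q₁ with hψ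
  have hψm : ψ ∈ IsManifold.maximalAtlas (𝓡 2) ∞ Q := chartAt_mem q₁
  have hq₁φ : q₁ ∈ φ.source := φ.map_target hz
  have hq₁ψ : q₁ ∈ ψ.source := mem_chart_source E2 q₁
  have hsmooth : ContDiffAt ℝ ∞ (fun w : E2 × E2Dual =>
      w.2.comp (fderiv ℝ (φ ∘ ψ.symm) ((ψ ∘ φ.symm) w.1))) z := by
    refine contDiffAt_snd.clm_comp ?_
    have h1 : ContDiffAt ℝ ∞ (fderiv ℝ (φ ∘ ψ.symm)) ((ψ ∘ φ.symm) z.1) := by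
      refine (contDiffAt_transition hφ hψm (ψ.map_source hq₁ψ) ?_).fderiv_right (by simp)
      show ψ.symm (ψ q₁) ∈ φ.source
      rwa [ψ.left_inv hq₁ψ]
    have h2 : ContDiffAt ℝ ∞ (ψ ∘ φ.symm) z.1 := contDiffAt_transition hψm hφ hz hq₁ψ
    exact h1.comp z (h2.comp z contDiffAt_fst)
  refine hsmooth.contMDiffAt.congr_of_eventuallyEq ?_
  have hev : ∀ᶠ w : E2 × E2Dual in 𝓝 z, w.1 ∈ φ.target ∧ φ.symm w.1 ∈ ψ.source :=
    (continuous_fst.continuousAt.eventually (φ.open_target.mem_nhds hz)).and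
      (hbase.continuousAt.eventually (ψ.open_source.mem_nhds hq₁ψ))
  filter_upwards [hev] with w hw
  have h3 := hom_coordinates (φ.symm z.1) (cotangentLift φ w)
  refine h3.trans ?_
  have h4 := chartDeriv_comp_symmL hφ (φ.map_target hw.1) hw.2
  show (w.2.comp (chartDeriv φ (φ.symm w.1))).comp _ = _
  ext v : 1
  exact congrArg w.2 (DFunLike.congr_fun h4 v)

/-- The momentum is the fibre coordinate of the bundle composed with the derivative of ψ ∘ φ⁻¹, the
reverse of the transition used for the lift. -/
theorem contMDiffAt_cotangentCoord (hφ : φ ∈ IsManifold.maximalAtlas (𝓡 2) ∞ Q)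
    {α : CotangentBundle Q} (hα : α.proj ∈ φ.source) :
    ContMDiffAt cotModel 𝓘(ℝ, E2 × E2Dual) ∞ (cotangentCoord φ) α := by
  have hproj : ContMDiffAt cotModel (𝓡 2) ∞ (fun β : CotangentBundle Q => β.proj) α :=
    contMDiffAt_proj _
  have hcoord := ((contMDiffAt_hom_bundle (fun β : CotangentBundle Q => β)).1
    (contMDiffAt_id : ContMDiffAt cotModel cotModel ∞ (fun β : CotangentBundle Q => β) α)).2
  set ψ := chartAt E2 α.proj with hψ
  have hψm : ψ ∈ IsManifold.maximalAtlas (𝓡 2) ∞ Q := chartAt_mem α.proj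
  have hαψ : α.proj ∈ ψ.source := mem_chart_source E2 α.proj
  have hφα : ContMDiffAt cotModel 𝓘(ℝ, E2) ∞ (fun β : CotangentBundle Q => φ β.proj) α :=
    (contMDiffAt_chart hφ hα).comp α hproj
  have hmat : ContMDiffAt cotModel 𝓘(ℝ, E2 →L[ℝ] E2) ∞
      (fun β : CotangentBundle Q => fderiv ℝ (ψ ∘ φ.symm) (φ β.proj)) α := by
    have h1 : ContDiffAt ℝ ∞ (fderiv ℝ (ψ ∘ φ.symm)) (φ α.proj) := by
      refine (contDiffAt_transition hψm hφ (φ.map_source hα) ?_).fderiv_right (by simp)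
      rwa [φ.left_inv hα]
    exact h1.contMDiffAt.comp α hφα
  refine ContMDiffAt.prodMk_space hφα ?_
  refine (hcoord.clm_comp hmat).congr_of_eventuallyEq ?_
  have hev : ∀ᶠ β : CotangentBundle Q in 𝓝 α, β.proj ∈ φ.source ∧ β.proj ∈ ψ.source :=
    hproj.continuousAt.eventually
      (inter_mem (φ.open_source.mem_nhds hα) (ψ.open_source.mem_nhds hαψ))
  filter_upwards [hev] with β hβ
  have h3 := hom_coordinates α.proj β
  have h4 := (isInvertible_chartDeriv hφ hβ.1).self_comp_inverse
  have h5 := fderiv_transition_comp hψm hφ hβ.2 hβ.1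
  show β.snd.comp (chartDeriv φ β.proj).inverse = _
  ext v : 1
  have h6 : (chartDeriv φ β.proj) ((chartDeriv φ β.proj).inverse v) = v :=
    DFunLike.congr_fun h4 v
  have h7 := DFunLike.congr_fun h5 ((chartDeriv φ β.proj).inverse v)
  rw [ContinuousLinearMap.comp_apply, h6] at h7
  have h8 := symmL_chartDeriv hβ.2 ((chartDeriv φ β.proj).inverse v)
  rw [← h7] at h8
  refine (congrArg β.snd h8).symm.trans ?_
  exact (DFunLike.congr_fun h3 _).symm

end CotangentChart
end LCB

/-! ### The symplectic form and Hamilton's equations in induced coordinates. -/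

namespace LCB

/-- A nondegenerate bilinear form on a finite-dimensional space is invertible as a map to the
dual space. -/
theorem isInvertible_of_nondegenerate {E : Type*} [NormedAddCommGroup E] [NormedSpace ℝ E]
    [FiniteDimensional ℝ E] (B : E →L[ℝ] E →L[ℝ] ℝ) (hB : ∀ x, (∀ y, B x y = 0) → x = 0) :
    B.IsInvertible := by
  have hinj : Function.Injective B.toLinearMap :=
    (injective_iff_map_eq_zero _).2 fun x hx => hB x fun y => DFunLike.congr_fun hx y
  have hdim : Module.finrank ℝ E = Module.finrank ℝ (E →L[ℝ] ℝ) := by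
    rw [← (LinearMap.toContinuousLinearMap : (E →ₗ[ℝ] ℝ) ≃ₗ[ℝ] E →L[ℝ] ℝ).finrank_eq]
    exact Subspace.dual_finrank_eq.symm
  refine ⟨(LinearEquiv.ofInjectiveOfFinrankEq B.toLinearMap hinj hdim).toContinuousLinearEquiv, ?_⟩
  rfl

theorem stdSymplectic_apply (x y : E2 × E2Dual) :
    stdSymplectic x y = y.2 x.1 - x.2 y.1 := by
  rfl

theorem stdSymplectic_nondegenerate (x : E2 × E2Dual) (hx : ∀ y, stdSymplectic x y = 0) :
    x = 0 := by
  refine Prod.ext ?_ ?_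
  · ext i
    simpa [stdSymplectic_apply] using hx (0, EuclideanSpace.proj i)
  · ext v
    simpa [stdSymplectic_apply] using hx (v, 0)

/-- The cotangent lift of a diffeomorphism is symplectic. -/
theorem stdSymplectic_fderiv {T : E2 × E2Dual → E2 × E2Dual} {τ : E2 → E2} {z₀ : E2 × E2Dual}
    (hT : DifferentiableAt ℝ T z₀) (hτ : ContDiffAt ℝ ∞ τ z₀.1)
    (h : ∀ᶠ z in 𝓝 z₀, (T z).1 = τ z.1 ∧ z.2 = (T z).2.comp (fderiv ℝ τ z.1))
    (x y : E2 × E2Dual) :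
    stdSymplectic (fderiv ℝ T z₀ x) (fderiv ℝ T z₀ y) = stdSymplectic x y := by
  have hfst : ∀ u, (fderiv ℝ T z₀ u).1 = fderiv ℝ τ z₀.1 u.1 := by
    intro u
    have h1 : HasFDerivAt (fun z => (T z).1) _ z₀ := hT.hasFDerivAt.fst
    have h2 : HasFDerivAt (fun z : E2 × E2Dual => τ z.1) _ z₀ :=
      (hτ.differentiableAt (by simp)).hasFDerivAt.comp z₀ hasFDerivAt_fst
    have h3 := h1.unique (h2.congr_of_eventuallyEq (h.mono fun z hz => hz.1))
    exact DFunLike.congr_fun h3 u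
  have hsnd : ∀ u : E2 × E2Dual, ∀ v : E2, u.2 v =
      (T z₀).2 (fderiv ℝ (fderiv ℝ τ) z₀.1 u.1 v) + (fderiv ℝ T z₀ u).2 (fderiv ℝ τ z₀.1 v) := by
    intro u v
    have h1 : HasFDerivAt (fun z => (T z).2) _ z₀ := hT.hasFDerivAt.snd
    have h2 : HasFDerivAt (fun z : E2 × E2Dual => fderiv ℝ τ z.1) _ z₀ :=
      (((hτ.fderiv_right (m := ∞) (by simp)).differentiableAt
        (by simp)).hasFDerivAt).comp z₀ hasFDerivAt_fst
    have h3 := h1.clm_comp h2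
    have h4 : HasFDerivAt (fun z : E2 × E2Dual => z.2) _ z₀ := hasFDerivAt_snd (𝕜 := ℝ)
    have h5 := h4.unique (h3.congr_of_eventuallyEq (h.mono fun z hz => hz.2))
    have h6 := DFunLike.congr_fun (DFunLike.congr_fun h5 u) v
    simpa using h6
  -- Differentiating p = P ∘ Dτ produces the term P(D²τ(·, ·)). It cancels in the antisymmetric form
  -- because second derivatives commute.
  have hsymm := (hτ.isSymmSndFDerivAt (by simpa using ENat.LEInfty.out)).eq x.1 y.1
  rw [stdSymplectic_apply, stdSymplectic_apply, hfst, hfst, hsnd x, hsnd y, hsymm]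
  ring

section CotangentChart

variable {Q : Type*} [TopologicalSpace Q] [ChartedSpace E2 Q] [IsManifold (𝓡 2) ∞ Q]
  {φ : OpenPartialHomeomorph Q E2}

/-- The differential at `α` of the coordinates of `T*Q` induced by `φ`. -/
noncomputable def cotangentDeriv (φ : OpenPartialHomeomorph Q E2) (α : CotangentBundle Q) :
    TangentSpace cotModel α →L[ℝ] E2 × E2Dual :=
  mfderiv cotModel 𝓘(ℝ, E2 × E2Dual) (cotangentCoord φ) α

theorem hasMFDerivAt_cotangentCoord (hφ : φ ∈ IsManifold.maximalAtlas (𝓡 2) ∞ Q)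
    {α : CotangentBundle Q} (hα : α.proj ∈ φ.source) :
    HasMFDerivAt cotModel 𝓘(ℝ, E2 × E2Dual) (cotangentCoord φ) α (cotangentDeriv φ α) :=
  ((contMDiffAt_cotangentCoord hφ hα).mdifferentiableAt (by simp)).hasMFDerivAt

theorem eventually_proj_mem {α : CotangentBundle Q} {U : Set Q} (hU : IsOpen U)
    (hα : α.proj ∈ U) : ∀ᶠ β : CotangentBundle Q in 𝓝 α, β.proj ∈ U :=
  (FiberBundle.continuous_proj E2Dual
    (fun q : Q => TangentSpace (𝓡 2) q →L[ℝ] ℝ)).continuousAt.eventually (hU.mem_nhds hα)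

theorem isOpen_cotangentOver {U : Set Q} (hU : IsOpen U) :
    IsOpen (cotangentOver U : Set (CotangentBundle Q)) :=
  hU.preimage (FiberBundle.continuous_proj E2Dual
    (fun q : Q => TangentSpace (𝓡 2) q →L[ℝ] ℝ))

theorem eventually_fst_mem {z : E2 × E2Dual} {U : Set E2} (hU : IsOpen U) (hz : z.1 ∈ U) :
    ∀ᶠ w : E2 × E2Dual in 𝓝 z, w.1 ∈ U :=
  continuous_fst.continuousAt.eventually (hU.mem_nhds hz)

theorem hasMFDerivAt_cotangentLift (hφ : φ ∈ IsManifold.maximalAtlas (𝓡 2) ∞ Q)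
    {α : CotangentBundle Q} (hα : α.proj ∈ φ.source) :
    HasMFDerivAt 𝓘(ℝ, E2 × E2Dual) cotModel (cotangentLift φ) (cotangentCoord φ α)
      (mfderiv 𝓘(ℝ, E2 × E2Dual) cotModel (cotangentLift φ) (cotangentCoord φ α)) :=
  ((contMDiffAt_cotangentLift hφ (φ.map_source hα)).mdifferentiableAt (by simp)).hasMFDerivAt

/-- The chain rule, applied to both composites of the coordinates with the lift. -/
theorem isInvertible_cotangentDeriv (hφ : φ ∈ IsManifold.maximalAtlas (𝓡 2) ∞ Q)
    {α : CotangentBundle Q} (hα : α.proj ∈ φ.source) : (cotangentDeriv φ α).IsInvertible := by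
  have h1 := hasMFDerivAt_cotangentCoord hφ hα
  have h2 := hasMFDerivAt_cotangentLift hφ hα
  have hz : (cotangentCoord φ α).1 ∈ φ.target := φ.map_source hα
  have h3 := h2.comp α h1
  have h1' : HasMFDerivAt cotModel 𝓘(ℝ, E2 × E2Dual) (cotangentCoord φ)
      (cotangentLift φ (cotangentCoord φ α)) (cotangentDeriv φ α) := by
    -- Returning to α is only a propositional equality, and tangent spaces depend on the point, so
    -- the base point is replaced by substitution.
    have key : ∀ β, β = α →
        HasMFDerivAt cotModel 𝓘(ℝ, E2 × E2Dual) (cotangentCoord φ) β (cotangentDeriv φ α) := by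
      rintro _ rfl
      exact h1
    exact key _ (cotangentLift_coord hφ hα)
  have h4 := h1'.comp (cotangentCoord φ α) h2
  have e1 : (cotangentLift φ ∘ cotangentCoord φ : CotangentBundle Q → _) =ᶠ[𝓝 α] id :=
    (eventually_proj_mem φ.open_source hα).mono fun β hβ => cotangentLift_coord hφ hβ
  have e2 : (cotangentCoord φ ∘ cotangentLift φ : E2 × E2Dual → _) =ᶠ[𝓝 (cotangentCoord φ α)] id :=
    (eventually_fst_mem φ.open_target hz).mono fun w hw => cotangentCoord_lift hφ hw
  have h5 := hasMFDerivAt_unique h3 ((hasMFDerivAt_id α).congr_of_eventuallyEq e1)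
  have h6 := hasMFDerivAt_unique h4 ((hasMFDerivAt_id _).congr_of_eventuallyEq e2)
  exact ContinuousLinearMap.IsInvertible.of_inverse h6 h5

theorem cotangentDeriv_inverse (hφ : φ ∈ IsManifold.maximalAtlas (𝓡 2) ∞ Q)
    {α : CotangentBundle Q} (hα : α.proj ∈ φ.source) (w : E2 × E2Dual) :
    cotangentDeriv φ α ((cotangentDeriv φ α).inverse w) = w :=
  DFunLike.congr_fun (isInvertible_cotangentDeriv hφ hα).self_comp_inverse w

theorem cotangentDeriv_injective (hφ : φ ∈ IsManifold.maximalAtlas (𝓡 2) ∞ Q)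
    {α : CotangentBundle Q} (hα : α.proj ∈ φ.source) :
    Function.Injective (cotangentDeriv φ α) :=
  (isInvertible_cotangentDeriv hφ hα).injective

/-- Any chart of `Q` induces canonical coordinates of `T*Q`. -/
theorem canonicalSymplectic_apply (hφ : φ ∈ IsManifold.maximalAtlas (𝓡 2) ∞ Q)
    {α : CotangentBundle Q} (hα : α.proj ∈ φ.source) (x y : TangentSpace cotModel α) :
    canonicalSymplectic α x y = stdSymplectic (cotangentDeriv φ α x) (cotangentDeriv φ α y) := by
  set ψ := chartAt E2 α.proj with hψ
  have hψm : ψ ∈ IsManifold.maximalAtlas (𝓡 2) ∞ Q := chartAt_mem α.proj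
  have hαψ : α.proj ∈ ψ.source := mem_chart_source E2 α.proj
  set z₀ := cotangentCoord ψ α with hz₀
  have hz₀t : z₀.1 ∈ ψ.target := ψ.map_source hαψ
  have hz₀s : ψ.symm z₀.1 = α.proj := ψ.left_inv hαψ
  -- The change between the two induced coordinate systems is the cotangent lift of the transition
  -- map, hence symplectic.
  let T : E2 × E2Dual → E2 × E2Dual := fun z =>
    cotangentCoord φ (cotangentLift ψ z : CotangentBundle Q)
  have hTs : ContMDiffAt 𝓘(ℝ, E2 × E2Dual) 𝓘(ℝ, E2 × E2Dual) ∞ T z₀ := by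
    refine ContMDiffAt.comp z₀ (contMDiffAt_cotangentCoord hφ ?_)
      (contMDiffAt_cotangentLift hψm hz₀t)
    show ψ.symm z₀.1 ∈ φ.source
    rwa [hz₀s]
  have hT : DifferentiableAt ℝ T z₀ := (contMDiffAt_iff_contDiffAt.1 hTs).differentiableAt (by simp)
  have hτ : ContDiffAt ℝ ∞ (φ ∘ ψ.symm) z₀.1 :=
    contDiffAt_transition hφ hψm hz₀t (by rwa [hz₀s])
  have hev : ∀ᶠ z in 𝓝 z₀, (T z).1 = (φ ∘ ψ.symm) z.1 ∧
      z.2 = (T z).2.comp (fderiv ℝ (φ ∘ ψ.symm) z.1) := by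
    have hopen : ∀ᶠ z : E2 × E2Dual in 𝓝 z₀, z.1 ∈ ψ.target ∩ ψ.symm ⁻¹' φ.source :=
      eventually_fst_mem (ψ.symm.isOpen_inter_preimage φ.open_source)
        ⟨hz₀t, by rw [mem_preimage, hz₀s]; exact hα⟩
    filter_upwards [hopen] with z hz
    refine ⟨rfl, ?_⟩
    have hq := ψ.map_target hz.1
    have h1 := fderiv_transition_comp hφ hψm hz.2 hq
    rw [ψ.right_inv hz.1] at h1
    have hi := isInvertible_chartDeriv hψm hq
    have hj := isInvertible_chartDeriv hφ hz.2
    ext v : 1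
    obtain ⟨u, rfl⟩ := hi.surjective v
    have h2 := DFunLike.congr_fun h1 u
    have h3 := DFunLike.congr_fun hj.inverse_comp_self u
    show _ = z.2 (chartDeriv ψ _ ((chartDeriv φ _).inverse (fderiv ℝ (φ ∘ ψ.symm) z.1 _)))
    rw [ContinuousLinearMap.comp_apply] at h2
    rw [h2]
    exact congrArg (fun w => z.2 (chartDeriv ψ _ w)) h3.symm
  have hcomp : ∀ u, cotangentDeriv φ α u = fderiv ℝ T z₀ (cotangentDeriv ψ α u) := by
    intro u
    have h1 := hT.hasFDerivAt.hasMFDerivAt.comp α (hasMFDerivAt_cotangentCoord hψm hαψ)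
    have e : T ∘ cotangentCoord ψ =ᶠ[𝓝 α] cotangentCoord φ :=
      (eventually_proj_mem ψ.open_source hαψ).mono fun β hβ =>
        congrArg (cotangentCoord φ) (cotangentLift_coord hψm hβ)
    have h2 := hasMFDerivAt_unique (hasMFDerivAt_cotangentCoord hφ hα)
      (h1.congr_of_eventuallyEq e.symm)
    exact DFunLike.congr_fun h2 u
  rw [hcomp, hcomp, stdSymplectic_fderiv hT hτ hev]
  rfl

/-- `hamiltonianVF` uses `ContinuousLinearMap.inverse`, which is zero on non-invertible maps.
Invertibility makes X_H the actual solution of ω(X_H, ·) = dH. -/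
theorem isInvertible_canonicalSymplectic (α : CotangentBundle Q) :
    (canonicalSymplectic α).IsInvertible := by
  have hα : α.proj ∈ (chartAt E2 α.proj).source := mem_chart_source E2 α.proj
  have hm := chartAt_mem α.proj
  refine isInvertible_of_nondegenerate (E := E2 × E2Dual) (canonicalSymplectic α) fun x hx => ?_
  have h0 : cotangentDeriv (chartAt E2 α.proj) α x = 0 := by
    refine stdSymplectic_nondegenerate _ fun y => ?_
    rw [← cotangentDeriv_inverse hm hα y]
    exact (canonicalSymplectic_apply hm hα x _).symm.trans (hx _)
  exact cotangentDeriv_injective hm hα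
    (h0.trans (map_zero (cotangentDeriv (chartAt E2 α.proj) α)).symm)

/-- The Hamiltonian vector field of `dqⁱ ∧ dpᵢ` for a differential `l`. -/
noncomputable def stdHamiltonian (l : E2 × E2Dual →L[ℝ] ℝ) : E2 × E2Dual :=
  (l (0, EuclideanSpace.proj 0) • EuclideanSpace.single 0 1 +
    l (0, EuclideanSpace.proj 1) • EuclideanSpace.single 1 1,
    -l.comp (ContinuousLinearMap.inl ℝ E2 E2Dual))

theorem covector_eq (p : E2Dual) : p = p (EuclideanSpace.single 0 1) • EuclideanSpace.proj 0 +
    p (EuclideanSpace.single 1 1) • EuclideanSpace.proj 1 := by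
  ext v
  have hv : v = v 0 • EuclideanSpace.single 0 (1 : ℝ) + v 1 • EuclideanSpace.single 1 (1 : ℝ) := by
    ext i
    fin_cases i <;> simp
  conv_lhs => rw [hv]
  simp [mul_comm]

theorem stdSymplectic_stdHamiltonian (l : E2 × E2Dual →L[ℝ] ℝ) (y : E2 × E2Dual) :
    stdSymplectic (stdHamiltonian l) y = l y := by
  obtain ⟨u, p⟩ := y
  have h1 : l (u, p) = l (u, 0) + l (0, p) := by
    rw [← map_add]; simp
  have h2 : l (0, p) = p (EuclideanSpace.single 0 1) * l (0, EuclideanSpace.proj 0) +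
      p (EuclideanSpace.single 1 1) * l (0, EuclideanSpace.proj 1) := by
    conv_lhs => rw [covector_eq p]
    rw [← smul_eq_mul, ← smul_eq_mul, ← map_smul, ← map_smul, ← map_add]
    simp
  rw [stdSymplectic_apply, h1, h2]
  simp [stdHamiltonian]
  ring

/-- The Hamiltonian vector field in the coordinates induced by a chart. -/
theorem cotangentDeriv_hamiltonianVF (hφ : φ ∈ IsManifold.maximalAtlas (𝓡 2) ∞ Q)
    {α : CotangentBundle Q} (hα : α.proj ∈ φ.source) {H : CotangentBundle Q → ℝ}
    {K : E2 × E2Dual → ℝ} (hK : DifferentiableAt ℝ K (cotangentCoord φ α))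
    (hH : H =ᶠ[𝓝 α] K ∘ cotangentCoord φ) :
    cotangentDeriv φ α (hamiltonianVF H α) =
      stdHamiltonian (fderiv ℝ K (cotangentCoord φ α)) := by
  set x := (cotangentDeriv φ α).inverse (stdHamiltonian (fderiv ℝ K (cotangentCoord φ α))) with hx
  have h1 : HasMFDerivAt cotModel 𝓘(ℝ, ℝ) H α
      ((fderiv ℝ K (cotangentCoord φ α)).comp (cotangentDeriv φ α)) :=
    (hK.hasFDerivAt.hasMFDerivAt.comp α
      (hasMFDerivAt_cotangentCoord hφ hα)).congr_of_eventuallyEq hH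
  have h2 : canonicalSymplectic α x = mfderiv cotModel 𝓘(ℝ, ℝ) H α := by
    rw [h1.mfderiv]
    ext y
    rw [canonicalSymplectic_apply hφ hα, hx, cotangentDeriv_inverse hφ hα,
      stdSymplectic_stdHamiltonian]
    rfl
  have h3 : hamiltonianVF H α = x := by
    rw [hamiltonianVF, ← h2]
    exact DFunLike.congr_fun (isInvertible_canonicalSymplectic α).inverse_comp_self x
  rw [h3, hx, cotangentDeriv_inverse hφ hα]

/-- The coordinates are linear on fibres, so the curve α + tβ becomes a straight line over a fixed
base point. -/
theorem cotangentDeriv_vlift (hφ : φ ∈ IsManifold.maximalAtlas (𝓡 2) ∞ Q)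
    {α : CotangentBundle Q} (hα : α.proj ∈ φ.source)
    (β : TangentSpace (𝓡 2) α.proj →L[ℝ] ℝ) :
    cotangentDeriv φ α (vlift α β) = (0, β.comp (chartDeriv φ α.proj).inverse) := by
  let c : ℝ → CotangentBundle Q := fun t => ⟨α.proj, α.snd + t • β⟩
  let line : ℝ → E2 × E2Dual := fun t => (φ α.proj,
    α.snd.comp (chartDeriv φ α.proj).inverse + t • β.comp (chartDeriv φ α.proj).inverse)
  have hline : ∀ t, cotangentCoord φ (c t) = line t := by
    intro t
    refine Prod.ext rfl ?_
    ext v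
    rfl
  have hc : c = cotangentLift φ ∘ line := by
    funext t
    rw [Function.comp_apply, ← hline]
    exact (cotangentLift_coord hφ (α := c t) hα).symm
  have hline' : HasDerivAt line (0, β.comp (chartDeriv φ α.proj).inverse) 0 := by
    refine (hasDerivAt_const (0 : ℝ) (φ α.proj)).prodMk ?_
    simpa using ((hasDerivAt_id (0 : ℝ)).smul_const
      (β.comp (chartDeriv φ α.proj).inverse)).const_add
        (α.snd.comp (chartDeriv φ α.proj).inverse)
  have hcd : MDifferentiableAt 𝓘(ℝ, ℝ) cotModel c 0 := by
    rw [hc]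
    exact MDifferentiableAt.comp (0 : ℝ)
      ((contMDiffAt_cotangentLift hφ (φ.map_source hα)).mdifferentiableAt (by simp))
      hline'.differentiableAt.mdifferentiableAt
  have key : ∀ γ, γ = α →
      HasMFDerivAt cotModel 𝓘(ℝ, E2 × E2Dual) (cotangentCoord φ) γ (cotangentDeriv φ α) := by
    rintro _ rfl
    exact hasMFDerivAt_cotangentCoord hφ hα
  have hc0 : c 0 = α := by simp [c]
  have h1 := (key (c 0) hc0).comp (0 : ℝ) hcd.hasMFDerivAt
  have h2 : HasMFDerivAt 𝓘(ℝ, ℝ) 𝓘(ℝ, E2 × E2Dual) (cotangentCoord φ ∘ c) 0 _ :=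
    hline'.hasFDerivAt.hasMFDerivAt.congr_of_eventuallyEq (Eventually.of_forall hline)
  have h3 := DFunLike.congr_fun (hasMFDerivAt_unique h1 h2) (1 : ℝ)
  refine Eq.trans h3 ?_
  exact one_smul ℝ ((0, β.comp (chartDeriv φ α.proj).inverse) : E2 × E2Dual)

end CotangentChart

/-! ### Metrics and simple functions in a chart. -/

section Metric

variable {Q : Type*} [TopologicalSpace Q] [ChartedSpace E2 Q]
  {φ : OpenPartialHomeomorph Q E2}

theorem coordDiff_eq (hφ : φ ∈ IsManifold.maximalAtlas (𝓡 2) ∞ Q) {q : Q} (hq : q ∈ φ.source)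
    (i : Fin 2) :
    coordDiff φ i q = (EuclideanSpace.proj i : E2 →L[ℝ] ℝ).comp (chartDeriv φ q) := by
  have h1 := ((EuclideanSpace.proj i : E2 →L[ℝ] ℝ).hasFDerivAt (x := φ q)).hasMFDerivAt.comp q
    ((contMDiffAt_chart hφ hq).mdifferentiableAt (by simp)).hasMFDerivAt
  exact h1.mfderiv

theorem chartDeriv_coordVec (hφ : φ ∈ IsManifold.maximalAtlas (𝓡 2) ∞ Q) {q : Q}
    (hq : q ∈ φ.source) (i : Fin 2) :
    chartDeriv φ q (coordVec φ i q) = EuclideanSpace.single i 1 :=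
  DFunLike.congr_fun (isInvertible_chartDeriv hφ hq).self_comp_inverse _

theorem tangentVector_eq (hφ : φ ∈ IsManifold.maximalAtlas (𝓡 2) ∞ Q) {q : Q}
    (hq : q ∈ φ.source) (u : TangentSpace (𝓡 2) q) :
    u = chartDeriv φ q u 0 • coordVec φ 0 q + chartDeriv φ q u 1 • coordVec φ 1 q := by
  apply (isInvertible_chartDeriv hφ hq).injective
  rw [map_add, map_smul, map_smul, chartDeriv_coordVec hφ hq, chartDeriv_coordVec hφ hq]
  ext i
  fin_cases i <;> simp

/-- A positive definite form is invertible as a map to the dual space. -/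
theorem isInvertible_of_pos {q : Q}
    (B : TangentSpace (𝓡 2) q →L[ℝ] TangentSpace (𝓡 2) q →L[ℝ] ℝ)
    (hB : ∀ u, u ≠ 0 → 0 < B u u) : B.IsInvertible := by
  refine isInvertible_of_nondegenerate (E := E2) B fun u hu => ?_
  by_contra h
  exact (hB u h).ne' (hu u)

theorem coordVec_ne_zero (hφ : φ ∈ IsManifold.maximalAtlas (𝓡 2) ∞ Q) {q : Q}
    (hq : q ∈ φ.source) {s t : ℝ} (h : s ≠ 0 ∨ t ≠ 0) :
    s • coordVec φ 0 q + t • coordVec φ 1 q ≠ 0 := by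
  intro h0
  have h1 := congrArg (chartDeriv φ q) h0
  rw [map_add, map_smul, map_smul, chartDeriv_coordVec hφ hq, chartDeriv_coordVec hφ hq,
    map_zero] at h1
  have h2 : s = 0 := by simpa using congrArg (fun v : E2 => v 0) h1
  have h3 : t = 0 := by simpa using congrArg (fun v : E2 => v 1) h1
  simp [h2, h3] at h

variable (g : ∀ q : Q, TangentSpace (𝓡 2) q →L[ℝ] TangentSpace (𝓡 2) q →L[ℝ] ℝ)

/-- The coefficients of a metric in a chart. -/
noncomputable def gramCoeff (φ : OpenPartialHomeomorph Q E2) (i j : Fin 2) (q : Q) : ℝ :=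
  g q (coordVec φ i q) (coordVec φ j q)

variable {g}

theorem gram_pos (hφ : φ ∈ IsManifold.maximalAtlas (𝓡 2) ∞ Q) {q : Q} (hq : q ∈ φ.source)
    (hsymm : ∀ u w, g q u w = g q w u) (hpos : ∀ u, u ≠ 0 → 0 < g q u u) :
    0 < gramCoeff g φ 0 0 q ∧ 0 < gramCoeff g φ 1 1 q ∧
      gramCoeff g φ 1 0 q = gramCoeff g φ 0 1 q ∧
      0 < gramCoeff g φ 0 0 q * gramCoeff g φ 1 1 q - gramCoeff g φ 0 1 q ^ 2 := by
  have key : ∀ s t : ℝ, s ≠ 0 ∨ t ≠ 0 → 0 < s ^ 2 * gramCoeff g φ 0 0 q +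
      2 * s * t * gramCoeff g φ 0 1 q + t ^ 2 * gramCoeff g φ 1 1 q := by
    intro s t hst
    have h1 := hpos _ (coordVec_ne_zero hφ hq hst)
    simp only [map_add, map_smul, _root_.add_apply, _root_.smul_apply,
      smul_eq_mul] at h1
    rw [hsymm (coordVec φ 1 q) (coordVec φ 0 q)] at h1
    simp only [gramCoeff]
    linarith
  have h00 : 0 < gramCoeff g φ 0 0 q := by simpa using key 1 0 (by simp)
  have h11 : 0 < gramCoeff g φ 1 1 q := by simpa using key 0 1 (by simp)
  refine ⟨h00, h11, hsymm _ _, ?_⟩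
  -- On the vector (g₀₁, -g₀₀) the quadratic form takes the value g₀₀ times the determinant.
  have h2 := key (gramCoeff g φ 0 1 q) (-gramCoeff g φ 0 0 q) (Or.inr (by simpa using h00.ne'))
  have h3 : 0 < gramCoeff g φ 0 0 q *
      (gramCoeff g φ 0 0 q * gramCoeff g φ 1 1 q - gramCoeff g φ 0 1 q ^ 2) := by linarith
  exact pos_of_mul_pos_right h3 h00.le

theorem kineticMatrix_eq (q : Q) : kineticMatrix g φ q =
    (gramCoeff g φ 0 0 q * gramCoeff g φ 1 1 q - gramCoeff g φ 0 1 q * gramCoeff g φ 1 0 q)⁻¹ •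
      !![gramCoeff g φ 1 1 q, -gramCoeff g φ 0 1 q; -gramCoeff g φ 1 0 q, gramCoeff g φ 0 0 q] := by
  rw [kineticMatrix, Matrix.inv_def, Matrix.det_fin_two, Matrix.adjugate_fin_two,
    Ring.inverse_eq_inv']
  rfl

/-- The local expression of a simple function. -/
theorem simpleFn_eq (hφ : φ ∈ IsManifold.maximalAtlas (𝓡 2) ∞ Q) (v : Q → ℝ)
    {α : CotangentBundle Q} (hα : α.proj ∈ φ.source)
    (hsymm : ∀ u w, g α.proj u w = g α.proj w u) (hpos : ∀ u, u ≠ 0 → 0 < g α.proj u u) :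
    simpleFn g v α =
      1 / 2 * (kineticMatrix g φ α.proj 0 0 *
          (cotangentCoord φ α).2 (EuclideanSpace.single 0 1) ^ 2 +
        2 * kineticMatrix g φ α.proj 0 1 * (cotangentCoord φ α).2 (EuclideanSpace.single 0 1) *
          (cotangentCoord φ α).2 (EuclideanSpace.single 1 1) +
        kineticMatrix g φ α.proj 1 1 *
          (cotangentCoord φ α).2 (EuclideanSpace.single 1 1) ^ 2) + v α.proj := by
  obtain ⟨h00, h11, h10, hdet⟩ := gram_pos hφ hα hsymm hpos
  set q := α.proj with hq
  set u := (g q).inverse α.snd with hu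
  have hgu : g q u = α.snd :=
    DFunLike.congr_fun (isInvertible_of_pos (g q) hpos).self_comp_inverse α.snd
  set s := chartDeriv φ q u 0 with hs
  set t := chartDeriv φ q u 1 with ht
  have hdec : u = s • coordVec φ 0 q + t • coordVec φ 1 q := tangentVector_eq hφ hα u
  have hp : ∀ i, (cotangentCoord φ α).2 (EuclideanSpace.single i 1) =
      s * gramCoeff g φ 0 i q + t * gramCoeff g φ 1 i q := by
    intro i
    show α.snd (coordVec φ i q) = _
    rw [← hgu, hdec]
    simp [gramCoeff]
  have hαu : α.snd u = s * (s * gramCoeff g φ 0 0 q + t * gramCoeff g φ 1 0 q) +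
      t * (s * gramCoeff g φ 0 1 q + t * gramCoeff g φ 1 1 q) := by
    rw [← hgu]
    conv_lhs => rw [hdec]
    simp [gramCoeff]
    ring
  rw [simpleFn, ← hq, ← hu, hαu, hp, hp, kineticMatrix_eq, h10]
  simp
  field_simp
  ring

end Metric
end LCB

namespace LCB

/-! ### Smoothness of metric coefficients, and metrics built from coefficients. -/

section Metric

variable {Q : Type*} [TopologicalSpace Q] [ChartedSpace E2 Q]
  {φ : OpenPartialHomeomorph Q E2}

/-- The metric on the domain of a chart with given coefficient form. -/
noncomputable def pullbackForm (φ : OpenPartialHomeomorph Q E2) (B : E2 → E2 →L[ℝ] E2 →L[ℝ] ℝ)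
    (q : Q) : TangentSpace (𝓡 2) q →L[ℝ] TangentSpace (𝓡 2) q →L[ℝ] ℝ :=
  let d : E2 →L[ℝ] E2 := chartDeriv φ q
  (B (φ q)).bilinearComp d d

theorem pullbackForm_apply (B : E2 → E2 →L[ℝ] E2 →L[ℝ] ℝ) (q : Q) (u w : TangentSpace (𝓡 2) q) :
    pullbackForm φ B q u w = B (φ q) (chartDeriv φ q u) (chartDeriv φ q w) := rfl

variable [IsManifold (𝓡 2) ∞ Q]

/-- The coordinate field is the pullback of a constant field by the chart. -/
theorem contMDiffAt_coordVec (hφ : φ ∈ IsManifold.maximalAtlas (𝓡 2) ∞ Q) {q : Q}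
    (hq : q ∈ φ.source) (i : Fin 2) :
    ContMDiffAt (𝓡 2) (𝓡 2).tangent ∞
      (fun q' : Q => (⟨q', coordVec φ i q'⟩ : TangentBundle (𝓡 2) Q)) q := by
  have hconst : ContMDiffAt 𝓘(ℝ, E2) 𝓘(ℝ, E2).tangent ∞
      (fun z : E2 => (⟨z, EuclideanSpace.single i 1⟩ : TangentBundle 𝓘(ℝ, E2) E2)) (φ q) :=
    contMDiffAt_vectorSpace_iff_contDiffAt.2 contDiffAt_const
  exact hconst.mpullback_vectorField_preimage (contMDiffAt_chart hφ hq)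
    (isInvertible_chartDeriv hφ hq) (by simp)

theorem contMDiffAt_gramCoeff
    {g : ∀ q : Q, TangentSpace (𝓡 2) q →L[ℝ] TangentSpace (𝓡 2) q →L[ℝ] ℝ}
    (hφ : φ ∈ IsManifold.maximalAtlas (𝓡 2) ∞ Q) {q : Q} (hq : q ∈ φ.source)
    (hg : ContMDiffAt (𝓡 2) ((𝓡 2).prod 𝓘(ℝ, E2 →L[ℝ] E2 →L[ℝ] ℝ)) ∞
      (fun q : Q => TotalSpace.mk' (E2 →L[ℝ] E2 →L[ℝ] ℝ) q (g q)) q) (i j : Fin 2) :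
    ContMDiffAt (𝓡 2) 𝓘(ℝ, ℝ) ∞ (gramCoeff g φ i j) q := by
  have h := ContMDiffAt.clm_bundle_apply₂ (F₁ := E2) (F₂ := E2) (F₃ := ℝ)
    (E₁ := TangentSpace (𝓡 2)) (E₂ := TangentSpace (𝓡 2)) (E₃ := Bundle.Trivial Q ℝ)
    hg (contMDiffAt_coordVec hφ hq i) (contMDiffAt_coordVec hφ hq j)
  exact (contMDiffAt_totalSpace.1 h).2

/-- In the trivialization of the preferred chart the form is B pulled back by the derivative of a
transition map, which depends smoothly on both. -/
theorem contMDiffAt_pullbackForm (hφ : φ ∈ IsManifold.maximalAtlas (𝓡 2) ∞ Q) {q₁ : Q}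
    (hq₁ : q₁ ∈ φ.source) {B : E2 → E2 →L[ℝ] E2 →L[ℝ] ℝ} (hB : ContDiffAt ℝ ∞ B (φ q₁)) :
    ContMDiffAt (𝓡 2) ((𝓡 2).prod 𝓘(ℝ, E2 →L[ℝ] E2 →L[ℝ] ℝ)) ∞
      (fun q : Q => TotalSpace.mk' (E2 →L[ℝ] E2 →L[ℝ] ℝ) q (pullbackForm φ B q)) q₁ := by
  refine (contMDiffAt_hom_bundle (F₁ := E2) (F₂ := E2Dual)
    (E₁ := TangentSpace (𝓡 2)) (E₂ := fun q : Q => TangentSpace (𝓡 2) q →L[ℝ] ℝ) _).2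
      ⟨contMDiffAt_id, ?_⟩
  set ψ := chartAt E2 q₁ with hψ
  have hψm : ψ ∈ IsManifold.maximalAtlas (𝓡 2) ∞ Q := chartAt_mem q₁
  have hq₁ψ : q₁ ∈ ψ.source := mem_chart_source E2 q₁
  have hM : ContMDiffAt (𝓡 2) 𝓘(ℝ, E2 →L[ℝ] E2) ∞
      (fun q : Q => fderiv ℝ (φ ∘ ψ.symm) (ψ q)) q₁ := by
    have h1 : ContDiffAt ℝ ∞ (fderiv ℝ (φ ∘ ψ.symm)) (ψ q₁) := by
      refine (contDiffAt_transition hφ hψm (ψ.map_source hq₁ψ) ?_).fderiv_right (by simp)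
      rwa [ψ.left_inv hq₁ψ]
    exact h1.contMDiffAt.comp q₁ (contMDiffAt_chart hψm hq₁ψ)
  have hBq : ContMDiffAt (𝓡 2) 𝓘(ℝ, E2 →L[ℝ] E2 →L[ℝ] ℝ) ∞ (fun q : Q => B (φ q)) q₁ :=
    hB.contMDiffAt.comp q₁ (contMDiffAt_chart hφ hq₁)
  have hpair := hBq.prodMk_space hM
  have hbil : ContDiff ℝ ∞ (fun x : (E2 →L[ℝ] E2 →L[ℝ] ℝ) × (E2 →L[ℝ] E2) =>
      x.1.bilinearComp x.2 x.2) := by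
    refine contDiff_clm_apply_iff.2 fun v => contDiff_clm_apply_iff.2 fun w => ?_
    exact (contDiff_fst.clm_apply (contDiff_snd.clm_apply contDiff_const)).clm_apply
      (contDiff_snd.clm_apply contDiff_const)
  refine (hbil.contMDiff.contMDiffAt.comp q₁ hpair).congr_of_eventuallyEq ?_
  have hev : ∀ᶠ q in 𝓝 q₁, q ∈ φ.source ∧ q ∈ ψ.source :=
    inter_mem (φ.open_source.mem_nhds hq₁) (ψ.open_source.mem_nhds hq₁ψ)
  filter_upwards [hev] with q hq
  ext v w
  have h4 := chartDeriv_comp_symmL hφ hq.1 hq.2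
  have hv : chartDeriv φ q ((trivializationAt E2 (TangentSpace (𝓡 2)) q₁).symmL ℝ q v) =
    fderiv ℝ (φ ∘ ψ.symm) (ψ q) v := DFunLike.congr_fun h4 v
  have hw : chartDeriv φ q ((trivializationAt E2 (TangentSpace (𝓡 2)) q₁).symmL ℝ q w) =
    fderiv ℝ (φ ∘ ψ.symm) (ψ q) w := DFunLike.congr_fun h4 w
  show _ = B (φ q) (fderiv ℝ (φ ∘ ψ.symm) (ψ q) v) (fderiv ℝ (φ ∘ ψ.symm) (ψ q) w)
  rw [← hv, ← hw]
  refine (inCoordinates_apply_eq₂ (F₁ := E2) (F₂ := E2) (F₃ := ℝ) (E₁ := TangentSpace (𝓡 2))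
    (E₂ := TangentSpace (𝓡 2)) (E₃ := Bundle.Trivial Q ℝ) (x₀ := q₁) (x := q)
    (by simpa using hq.2) (by simpa using hq.2) (by simp)).trans ?_
  have hs : ∀ x : E2, (trivializationAt E2 (TangentSpace (𝓡 2)) q₁).symmL ℝ q x =
      (trivializationAt E2 (TangentSpace (𝓡 2)) q₁).symm q x := 
    Trivialization.symmL_apply _ (by simpa using hq.2)
  rw [hs v, hs w]
  simp [pullbackForm_apply]

end Metric
end LCB

namespace LCB

/-! ### Simple functions on ℝ² × (ℝ²)* and the algebra of the control. -/

section LocalModel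

/-- The simple function with kinetic coefficients `a`, `b`, `c` and potential `h` on
`ℝ² × (ℝ²)*`. -/
noncomputable def localSimple (a b c h : E2 → ℝ) (z : E2 × E2Dual) : ℝ :=
  1 / 2 * (a z.1 * z.2 (EuclideanSpace.single 0 1) ^ 2 +
    2 * b z.1 * z.2 (EuclideanSpace.single 0 1) * z.2 (EuclideanSpace.single 1 1) +
    c z.1 * z.2 (EuclideanSpace.single 1 1) ^ 2) + h z.1

theorem contDiffOn_evalSnd (e : E2) (s : Set (E2 × E2Dual)) :
    ContDiffOn ℝ ∞ (fun z : E2 × E2Dual => z.2 e) s :=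
  (contDiff_snd.clm_apply contDiff_const).contDiffOn

theorem contDiffOn_comp_fst {U : Set E2} {f : E2 → ℝ} (hf : ContDiffOn ℝ ∞ f U) :
    ContDiffOn ℝ ∞ (fun z : E2 × E2Dual => f z.1) (U ×ˢ univ) :=
  hf.comp contDiffOn_fst fun _ hz => hz.1

theorem contDiffOn_localSimple {U : Set E2} {a b c h : E2 → ℝ} (ha : ContDiffOn ℝ ∞ a U)
    (hb : ContDiffOn ℝ ∞ b U) (hc : ContDiffOn ℝ ∞ c U) (hh : ContDiffOn ℝ ∞ h U) :
    ContDiffOn ℝ ∞ (localSimple a b c h) (U ×ˢ univ) := by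
  have ha' := contDiffOn_comp_fst ha
  have hb' := contDiffOn_comp_fst hb
  have hc' := contDiffOn_comp_fst hc
  have hh' := contDiffOn_comp_fst hh
  have h0 := contDiffOn_evalSnd (EuclideanSpace.single 0 1) (U ×ˢ univ)
  have h1 := contDiffOn_evalSnd (EuclideanSpace.single 1 1) (U ×ˢ univ)
  exact contDiffOn_const.mul (((ha'.mul (h0.pow 2)).add
    (((contDiffOn_const.mul hb').mul h0).mul h1)).add (hc'.mul (h1.pow 2))) |>.add hh'

/-- Restricting to the line through z in the direction (x, y) reduces the computation to
one-variable rules. -/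
theorem fderiv_localSimple {a b c h : E2 → ℝ} {z : E2 × E2Dual} (ha : DifferentiableAt ℝ a z.1)
    (hb : DifferentiableAt ℝ b z.1) (hc : DifferentiableAt ℝ c z.1)
    (hh : DifferentiableAt ℝ h z.1) (x : E2) (y : E2Dual) :
    fderiv ℝ (localSimple a b c h) z (x, y) =
      1 / 2 * (fderiv ℝ a z.1 x * z.2 (EuclideanSpace.single 0 1) ^ 2 +
        2 * fderiv ℝ b z.1 x * z.2 (EuclideanSpace.single 0 1) * z.2 (EuclideanSpace.single 1 1) +
        fderiv ℝ c z.1 x * z.2 (EuclideanSpace.single 1 1) ^ 2) + fderiv ℝ h z.1 x +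
      (a z.1 * z.2 (EuclideanSpace.single 0 1) + b z.1 * z.2 (EuclideanSpace.single 1 1)) *
        y (EuclideanSpace.single 0 1) +
      (b z.1 * z.2 (EuclideanSpace.single 0 1) + c z.1 * z.2 (EuclideanSpace.single 1 1)) *
        y (EuclideanSpace.single 1 1) := by
  have hf : ∀ {f : E2 → ℝ}, DifferentiableAt ℝ f z.1 →
      HasDerivAt (fun s : ℝ => f (z.1 + s • x)) (fderiv ℝ f z.1 x) 0 := by
    intro f hf
    have h1 : HasFDerivAt f (fderiv ℝ f z.1) (z.1 + (0 : ℝ) • x) := by simpa using hf.hasFDerivAt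
    have h2 : HasDerivAt (fun s : ℝ => z.1 + s • x) x 0 := by
      simpa using ((hasDerivAt_id (0 : ℝ)).smul_const x).const_add z.1
    exact h1.comp_hasDerivAt 0 h2
  have hp : ∀ e : E2, HasDerivAt (fun s : ℝ => z.2 e + s * y e) (y e) 0 := by
    intro e
    simpa using ((hasDerivAt_id (0 : ℝ)).mul_const (y e)).const_add (z.2 e)
  have hd : DifferentiableAt ℝ (localSimple a b c h) z := by
    unfold localSimple
    have ha' : DifferentiableAt ℝ (fun z : E2 × E2Dual => a z.1) z := ha.comp z differentiableAt_fst
    have hb' : DifferentiableAt ℝ (fun z : E2 × E2Dual => b z.1) z := hb.comp z differentiableAt_fst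
    have hc' : DifferentiableAt ℝ (fun z : E2 × E2Dual => c z.1) z := hc.comp z differentiableAt_fst
    have hh' : DifferentiableAt ℝ (fun z : E2 × E2Dual => h z.1) z := hh.comp z differentiableAt_fst
    have he : ∀ e : E2, DifferentiableAt ℝ (fun z : E2 × E2Dual => z.2 e) z := fun e =>
      differentiableAt_snd.clm_apply (differentiableAt_const e)
    have h0 := he (EuclideanSpace.single 0 1)
    have h1 := he (EuclideanSpace.single 1 1)
    fun_prop
  have h1 : HasDerivAt (fun s : ℝ => localSimple a b c h (z + s • (x, y)))
      (fderiv ℝ (localSimple a b c h) z (x, y)) 0 := by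
    have h1 : HasFDerivAt (localSimple a b c h) (fderiv ℝ (localSimple a b c h) z)
        (z + (0 : ℝ) • (x, y)) := by simpa using hd.hasFDerivAt
    have h2 : HasDerivAt (fun s : ℝ => z + s • (x, y)) (x, y) 0 := by
      simpa using ((hasDerivAt_id (0 : ℝ)).smul_const (x, y)).const_add z
    exact h1.comp_hasDerivAt 0 h2
  have h2 := (((((hf ha).mul ((hp (EuclideanSpace.single 0 1)).pow 2)).add
    ((((hf hb).const_mul 2).mul (hp (EuclideanSpace.single 0 1))).mul
      (hp (EuclideanSpace.single 1 1)))).add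
    ((hf hc).mul ((hp (EuclideanSpace.single 1 1)).pow 2))).const_mul (1 / 2)).add (hf hh)
  refine (h1.unique h2).trans ?_
  simp
  ring

/-- The coefficient of the control that makes the function with coefficients `ga`, `-be`, `al`
a first integral; subscripts stand for partial derivatives. -/
noncomputable def controlValue
    (a b c dxa dxb dxc dya dyb dyc hy al be ga alx bex gax aly bey gay vx vy p₁ p₂ : ℝ) :
    ℝ :=
  let w₁ := ga * p₁ - be * p₂
  let w₂ := al * p₂ - be * p₁
  let rx := 2 * w₁ * (gax * al * be - bex * (al * ga + be * be) + alx * be * ga) +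
    w₂ * (gax * be ^ 2 - 2 * bex * be * ga + alx * ga ^ 2)
  let ry := 2 * w₁ * (gay * al * be - bey * (al * ga + be * be) + aly * be * ga) +
    w₂ * (gay * be ^ 2 - 2 * bey * be * ga + aly * ga ^ 2)
  let qx := 2 * w₁ * (dxa * al * be + dxb * (al * ga + be * be) + dxc * be * ga) +
    w₂ * (dxa * be ^ 2 + 2 * dxb * be * ga + dxc * ga ^ 2)
  1 / 2 * w₁ * qx + 1 / 2 * (dya * p₁ ^ 2 + 2 * dyb * p₁ * p₂ + dyc * p₂ ^ 2) + hy -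
    (1 / 2 * (w₁ * ((a * al + b * be) * rx + (b * al + c * be) * ry) +
      (a * be + b * ga) * (gax * p₁ ^ 2 - 2 * bex * p₁ * p₂ + alx * p₂ ^ 2) +
      (b * be + c * ga) * (gay * p₁ ^ 2 - 2 * bey * p₁ * p₂ + aly * p₂ ^ 2)) +
    (a * be + b * ga) * vx + (b * be + c * ga) * vy)

/-- The left side is dV along the controlled field. In the variables w₁, w₂ the part free of w₂
vanishes by the two matching conditions, and the control is minus the quotient of the uncontrolled
derivative by w₂. The auxiliary `rx`, `ry`, `qx` are such quotients for the x- and y-derivatives of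
the kinetic term of V and the x-derivative of that of H. -/
theorem controlValue_spec
    {a b c dxa dxb dxc dya dyb dyc hx hy al be ga alx bex gax aly bey gay vx vy p₁ p₂ : ℝ}
    (hdet : al * ga - be ^ 2 = 1) (hdetx : alx * ga + al * gax - 2 * be * bex = 0)
    (hdety : aly * ga + al * gay - 2 * be * bey = 0)
    (hkin : (a * al + b * be) * alx + (b * al + c * be) * aly +
      (dxa * al ^ 2 + 2 * dxb * al * be + dxc * be ^ 2) = 0)
    (hpot : (a * al + b * be) * vx + (b * al + c * be) * vy = hx) :
    1 / 2 * (((a * p₁ + b * p₂) * gax + (b * p₁ + c * p₂) * gay) * p₁ ^ 2 +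
      2 * -((a * p₁ + b * p₂) * bex + (b * p₁ + c * p₂) * bey) * p₁ * p₂ +
      ((a * p₁ + b * p₂) * alx + (b * p₁ + c * p₂) * aly) * p₂ ^ 2) +
      ((a * p₁ + b * p₂) * vx + (b * p₁ + c * p₂) * vy) +
      (ga * p₁ + -be * p₂) * -(1 / 2 * (dxa * p₁ ^ 2 + 2 * dxb * p₁ * p₂ + dxc * p₂ ^ 2) + hx) +
      (-be * p₁ + al * p₂) * (-(1 / 2 * (dya * p₁ ^ 2 + 2 * dyb * p₁ * p₂ + dyc * p₂ ^ 2) + hy) +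
        controlValue a b c dxa dxb dxc dya dyb dyc hy al be ga alx bex gax aly bey gay vx vy p₁ p₂)
      = 0 := by
  obtain ⟨w₁, hw₁⟩ : ∃ w, w = ga * p₁ - be * p₂ := ⟨_, rfl⟩
  obtain ⟨w₂, hw₂⟩ : ∃ w, w = al * p₂ - be * p₁ := ⟨_, rfl⟩
  have hp₁ : p₁ = al * w₁ + be * w₂ := by rw [hw₁, hw₂]; linear_combination -p₁ * hdet
  have hp₂ : p₂ = be * w₁ + ga * w₂ := by rw [hw₁, hw₂]; linear_combination -p₂ * hdet
  have hw₁' : ga * p₁ + -be * p₂ = w₁ := by rw [hw₁]; ring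
  have hw₂' : -be * p₁ + al * p₂ = w₂ := by rw [hw₂]; ring
  -- On w₂ = 0 the derivatives of ga and be drop out: differentiating the determinant identity
  -- reduces the kinetic term to the derivative of al alone.
  have hrx : gax * al ^ 2 - 2 * bex * al * be + alx * be ^ 2 = -alx := by
    linear_combination al * hdetx - alx * hdet
  have hry : gay * al ^ 2 - 2 * bey * al * be + aly * be ^ 2 = -aly := by
    linear_combination al * hdety - aly * hdet
  simp only [controlValue]
  rw [hw₁', hw₂', ← hw₁, ← hw₂]
  rw [hp₁, hp₂]
  linear_combination (w₁ ^ 3 / 2) * ((a * al + b * be) * hrx + (b * al + c * be) * hry) -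
    (w₁ ^ 3 / 2) * hkin + w₁ * hpot

/-- The quotient by w₂ has been carried out algebraically, so the control is polynomial in its
arguments and smooth across w₂ = 0. -/
theorem contDiffOn_controlValue {X : Type} [NormedAddCommGroup X] [NormedSpace ℝ X] {s : Set X}
    {a b c dxa dxb dxc dya dyb dyc hy al be ga alx bex gax aly bey gay vx vy p₁ p₂ :
      X → ℝ}
    (h_a : ContDiffOn ℝ ∞ a s) (h_b : ContDiffOn ℝ ∞ b s) (h_c : ContDiffOn ℝ ∞ c s)
    (h_dxa : ContDiffOn ℝ ∞ dxa s) (h_dxb : ContDiffOn ℝ ∞ dxb s) (h_dxc : ContDiffOn ℝ ∞ dxc s)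
    (h_dya : ContDiffOn ℝ ∞ dya s) (h_dyb : ContDiffOn ℝ ∞ dyb s) (h_dyc : ContDiffOn ℝ ∞ dyc s)
    (h_hy : ContDiffOn ℝ ∞ hy s) (h_al : ContDiffOn ℝ ∞ al s) (h_be : ContDiffOn ℝ ∞ be s)
    (h_ga : ContDiffOn ℝ ∞ ga s) (h_alx : ContDiffOn ℝ ∞ alx s) (h_bex : ContDiffOn ℝ ∞ bex s)
    (h_gax : ContDiffOn ℝ ∞ gax s) (h_aly : ContDiffOn ℝ ∞ aly s) (h_bey : ContDiffOn ℝ ∞ bey s)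
    (h_gay : ContDiffOn ℝ ∞ gay s) (h_vx : ContDiffOn ℝ ∞ vx s) (h_vy : ContDiffOn ℝ ∞ vy s)
    (h_p₁ : ContDiffOn ℝ ∞ p₁ s) (h_p₂ : ContDiffOn ℝ ∞ p₂ s) :
    ContDiffOn ℝ ∞ (fun z => controlValue
        (a z) (b z) (c z) (dxa z) (dxb z) (dxc z) (dya z) (dyb z) (dyc z) (hy z) (al z) (be z)
        (ga z) (alx z) (bex z) (gax z) (aly z) (bey z) (gay z) (vx z) (vy z) (p₁ z) (p₂ z)) s := by
  simp only [controlValue]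
  fun_prop

end LocalModel
end LCB

namespace LCB

/-! ### Solving the matching conditions. -/

section LocalConstruction

theorem contDiffOn_partialDeriv {U : Set E2} (hU : IsOpen U) {f : E2 → ℝ}
    (hf : ContDiffOn ℝ ∞ f U) (i : Fin 2) : ContDiffOn ℝ ∞ (partialDeriv i f) U :=
  (hf.fderiv_of_isOpen hU (by simp)).clm_apply contDiffOn_const

theorem fderiv_apply_eq (f : E2 → ℝ) (z d : E2) :
    fderiv ℝ f z d = d 0 * partialDeriv 0 f z + d 1 * partialDeriv 1 f z := by
  have hd : d = d 0 • EuclideanSpace.single 0 (1 : ℝ) + d 1 • EuclideanSpace.single 1 (1 : ℝ) := by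
    ext i
    fin_cases i <;> simp
  conv_lhs => rw [hd]
  simp [partialDeriv]

/-- The direction along which both matching conditions are integrated. -/
theorem exists_direction {a b c hxx hxy : ℝ} (hc : 0 < c) (hdet : 0 < a * c - b ^ 2)
    (h : b * hxx + c * hxy ≠ 0 ∨ 0 < hxx) :
    ∃ d : E2, 0 < c * d 0 - b * d 1 ∧ 0 < d 0 * hxx + d 1 * hxy := by
  rcases h with h | h
  · set e := b * hxx + c * hxy
    -- With K = (a, b; b, c), the vector d = K(1, μ) makes the first quantity ac - b² for every μ;
    -- this μ makes the second equal to 1.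
    let μ : ℝ := (1 - (a * hxx + b * hxy)) / e
    refine ⟨!₂[a + b * μ, b + c * μ], ?_, ?_⟩
    · simp
      nlinarith
    · have : μ * e = 1 - (a * hxx + b * hxy) := div_mul_cancel₀ _ h
      simp
      simp only [e] at this
      nlinarith
  · exact ⟨!₂[1, 0], by simpa using hc, by simpa using h⟩

/-- Solution of the matching conditions: the metric coefficients `al`, `be` and the potential `v`
of a function that can be made a first integral by a force along the second coordinate. -/
theorem exists_matching {Ω : Set E2} (hΩ : IsOpen Ω) (h0 : (0 : E2) ∈ Ω) {a b c h : E2 → ℝ}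
    (ha : ContDiffOn ℝ ∞ a Ω) (hb : ContDiffOn ℝ ∞ b Ω) (hc : ContDiffOn ℝ ∞ c Ω)
    (hh : ContDiffOn ℝ ∞ h Ω) (hc0 : ∀ z ∈ Ω, 0 < c z)
    (hdet : ∀ z ∈ Ω, 0 < a z * c z - b z ^ 2) (hcrit : fderiv ℝ h 0 = 0)
    (hpos : b 0 * partialDeriv 0 (partialDeriv 0 h) 0 +
      c 0 * partialDeriv 1 (partialDeriv 0 h) 0 ≠ 0 ∨ 0 < partialDeriv 0 (partialDeriv 0 h) 0) :
    ∃ (U : Set E2) (al be v : E2 → ℝ), IsOpen U ∧ 0 ∈ U ∧ U ⊆ Ω ∧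
      ContDiffOn ℝ ∞ al U ∧ ContDiffOn ℝ ∞ be U ∧ ContDiffOn ℝ ∞ v U ∧
      (∀ z ∈ U, 0 < al z) ∧ v 0 = 0 ∧ (∀ z ∈ U, z ≠ 0 → 0 < v z) ∧
      ∀ z ∈ U,
        (a z * al z + b z * be z) * partialDeriv 0 al z +
          (b z * al z + c z * be z) * partialDeriv 1 al z +
          (partialDeriv 0 a z * al z ^ 2 + 2 * partialDeriv 0 b z * al z * be z +
            partialDeriv 0 c z * be z ^ 2) = 0 ∧
        (a z * al z + b z * be z) * partialDeriv 0 v z +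
          (b z * al z + c z * be z) * partialDeriv 1 v z = partialDeriv 0 h z := by
  obtain ⟨d, hd, hd'⟩ := exists_direction (hc0 0 h0) (hdet 0 h0) hpos
  have hdne : d ≠ 0 := by
    rintro rfl
    simp at hd'
  -- Orthogonal projection onto the line of d supplies a functional with `t d = 1`.
  let t : E2 →L[ℝ] ℝ := (‖d‖ ^ 2)⁻¹ • innerSL ℝ d
  have ht : t d = 1 := by
    have : ‖d‖ ≠ 0 := norm_ne_zero_iff.2 hdne
    simp [t, this]
  set Δ : E2 → ℝ := fun z => a z * c z - b z ^ 2 with hΔ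
  -- Cramer's rule for K(m, n) = d. Taking be = al · n / m then turns both transport operators into
  -- al / m times ∂_d.
  set m : E2 → ℝ := fun z => (c z * d 0 - b z * d 1) / Δ z with hm
  set n : E2 → ℝ := fun z => (a z * d 1 - b z * d 0) / Δ z with hn
  set W : Set E2 := Ω ∩ {z | 0 < c z * d 0 - b z * d 1} with hWdef
  have hWΩ : W ⊆ Ω := inter_subset_left
  have hW : IsOpen W :=
    ((hc.continuousOn.mul continuousOn_const).sub
      (hb.continuousOn.mul continuousOn_const)).isOpen_inter_preimage hΩ isOpen_Ioi
  have h0W : (0 : E2) ∈ W := ⟨h0, hd⟩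
  have hm0 : ∀ z ∈ W, 0 < m z := fun z hz => div_pos hz.2 (hdet z hz.1)
  have hΔs : ContDiffOn ℝ ∞ Δ W := ((ha.mul hc).sub (hb.pow 2)).mono hWΩ
  have hms : ContDiffOn ℝ ∞ m W :=
    (((hc.mul contDiffOn_const).sub (hb.mul contDiffOn_const)).mono hWΩ).div hΔs
      fun z hz => (hdet z hz.1).ne'
  have hns : ContDiffOn ℝ ∞ n W :=
    (((ha.mul contDiffOn_const).sub (hb.mul contDiffOn_const)).mono hWΩ).div hΔs
      fun z hz => (hdet z hz.1).ne'
  have hax := (contDiffOn_partialDeriv hΩ ha 0).mono hWΩ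
  have hbx := (contDiffOn_partialDeriv hΩ hb 0).mono hWΩ
  have hcx := (contDiffOn_partialDeriv hΩ hc 0).mono hWΩ
  have hhx := (contDiffOn_partialDeriv hΩ hh 0).mono hWΩ
  set S : E2 → ℝ := fun z => partialDeriv 0 a z * m z ^ 2 +
    2 * partialDeriv 0 b z * m z * n z + partialDeriv 0 c z * n z ^ 2 with hS
  have hSs : ContDiffOn ℝ ∞ S W :=
    ((hax.mul (hms.pow 2)).add (((contDiffOn_const.mul hbx).mul hms).mul hns)).add
      (hcx.mul (hns.pow 2))
  -- The segments of integration may leave W, so the right side is replaced by a global function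
  -- with the same germ at the origin.
  obtain ⟨F, hF, -, hFeq⟩ := exists_contDiff_eventuallyEq hW h0W
    (hSs.div hms fun z hz => (hm0 z hz).ne')
  -- The kinetic condition is linear in log al along d, so the exponential solves it and keeps al
  -- positive.
  set al : E2 → ℝ := fun z => Real.exp (-lineIntegral d t F z) with hal
  have hals : ContDiff ℝ ∞ al := (contDiff_lineIntegral d t hF).neg.exp
  have hal0 : ∀ z, 0 < al z := fun z => Real.exp_pos _
  have hald : ∀ z, fderiv ℝ al z d = -(al z * F z) := by
    intro z
    have h1 := ((contDiff_lineIntegral d t hF).differentiable (by simp) z).hasFDerivAt.neg.exp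
    have h2 := fderiv_lineIntegral ht hF z
    have h3 : fderiv ℝ al z = _ := h1.fderiv
    rw [h3]
    simp [hal, h2]
  have hGs : ContDiffOn ℝ ∞ (fun z => m z * partialDeriv 0 h z / al z) W :=
    (hms.mul hhx).div hals.contDiffOn fun z _ => (hal0 z).ne'
  obtain ⟨G, hG, -, hGeq⟩ := exists_contDiff_eventuallyEq hW h0W hGs
  have hhx0 : partialDeriv 0 h 0 = 0 := by simp [partialDeriv, hcrit]
  have hG0 : G 0 = 0 := by rw [hGeq.eq_of_nhds]; simp [hhx0]
  -- Since h_x vanishes at 0, the product rule leaves only (m / al) times ∂_d h_x, positive by the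
  -- choice of d.
  have hGd : 0 < fderiv ℝ G 0 d := by
    have h1 : HasFDerivAt (partialDeriv 0 h) (fderiv ℝ (partialDeriv 0 h) 0) 0 :=
      ((hhx.contDiffAt (hW.mem_nhds h0W)).differentiableAt (by simp)).hasFDerivAt
    have h2 : HasFDerivAt (fun z => m z / al z) _ 0 :=
      (((hms.div hals.contDiffOn fun z _ => (hal0 z).ne').contDiffAt
        (hW.mem_nhds h0W)).differentiableAt (by simp)).hasFDerivAt
    have h3 := (h2.mul h1).congr_of_eventuallyEq (hGeq.trans (Eventually.of_forall fun z => by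
      simp only [Pi.mul_apply]; ring))
    rw [h3.fderiv]
    have h4 := fderiv_apply_eq (partialDeriv 0 h) 0 d
    simp only [hhx0, zero_smul, add_zero, smul_apply, h4, smul_eq_mul]
    exact mul_pos (div_pos (hm0 0 h0W) (hal0 0)) hd'
  obtain ⟨k, hk⟩ := exists_lineIntegral_pos (t := t) hG.continuous
    (hG.differentiable (by simp) 0) hG0 hGd
  -- The added square is constant along d, so ∂_d v = G is unaffected.
  set v : E2 → ℝ := fun q => lineIntegral d t G q + k * ‖q - t q • d‖ ^ 2 with hv
  have hproj : ContDiff ℝ ∞ fun q : E2 => ‖q - t q • d‖ ^ 2 :=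
    (contDiff_id.sub (t.contDiff.smul contDiff_const)).norm_sq ℝ
  have hvs : ContDiff ℝ ∞ v := (contDiff_lineIntegral d t hG).add (contDiff_const.mul hproj)
  have hvd : ∀ z, fderiv ℝ v z d = G z := by
    intro z
    have h1 := ((contDiff_lineIntegral d t hG).differentiable (by simp) z).hasFDerivAt
    have h2 : HasFDerivAt (fun q : E2 => q - t q • d)
        (ContinuousLinearMap.id ℝ E2 - t.smulRight d) z :=
      (hasFDerivAt_id z).sub (t.hasFDerivAt.smul_const d)
    have h3 := h1.add (h2.norm_sq.const_mul k)
    have h4 : fderiv ℝ v z = _ := h3.fderiv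
    rw [h4]
    simp [ht, fderiv_lineIntegral ht hG z]
  obtain ⟨N, hN, hNo, h0N⟩ := mem_nhds_iff.1 ((hFeq.and hGeq).and hk)
  refine ⟨W ∩ N, al, fun z => al z * n z / m z, v, hW.inter hNo, ⟨h0W, h0N⟩,
    inter_subset_left.trans hWΩ, hals.contDiffOn, ?_, hvs.contDiffOn, fun z _ => hal0 z, ?_,
    fun z hz => (hN hz.2).2, ?_⟩
  · exact ((hals.contDiffOn.mul hns).div hms fun z hz => (hm0 z hz).ne').mono inter_subset_left
  · simp [hv, lineIntegral_zero]
  rintro z ⟨hzW, hzN⟩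
  obtain ⟨⟨hFz, hGz⟩, -⟩ := hN hzN
  have hmz := hm0 z hzW
  have hΔz : 0 < Δ z := hdet z hzW.1
  have halz := hal0 z
  have e0 : a z * m z + b z * n z = d 0 := by
    simp only [hm, hn]
    field_simp
    simp only [hΔ]
    ring
  have e1 : b z * m z + c z * n z = d 1 := by
    simp only [hm, hn]
    field_simp
    simp only [hΔ]
    ring
  have f0 : a z * al z + b z * (al z * n z / m z) = al z / m z * d 0 := by
    rw [← e0]; field_simp
  have f1 : b z * al z + c z * (al z * n z / m z) = al z / m z * d 1 := by
    rw [← e1]; field_simp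
  have hk1 := hald z
  have hk2 := hvd z
  rw [fderiv_apply_eq] at hk1 hk2
  simp only [Pi.div_apply] at hFz hGz
  constructor
  · rw [f0, f1]
    have : al z / m z * d 0 * partialDeriv 0 al z + al z / m z * d 1 * partialDeriv 1 al z =
        al z / m z * -(al z * (S z / m z)) := by
      rw [← hFz, ← hk1]; ring
    rw [this]
    simp only [hS]
    field_simp
    ring
  · rw [f0, f1]
    have : al z / m z * d 0 * partialDeriv 0 v z + al z / m z * d 1 * partialDeriv 1 v z =
        al z / m z * (m z * partialDeriv 0 h z / al z) := by
      rw [← hGz, ← hk2]; ring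
    rw [this]
    field_simp

theorem partialDeriv_neg (i : Fin 2) (f : E2 → ℝ) (z : E2) :
    partialDeriv i (fun z => -f z) z = -partialDeriv i f z := by
  simp [partialDeriv, fderiv_fun_neg]

/-- Hamilton's equations with the extra force u in the second momentum, substituted into the
differential of another simple function. -/
theorem fderiv_localSimple_stdHamiltonian {a b c h a' b' c' v : E2 → ℝ} {z : E2 × E2Dual}
    (ha : DifferentiableAt ℝ a z.1) (hb : DifferentiableAt ℝ b z.1)
    (hc : DifferentiableAt ℝ c z.1) (hh : DifferentiableAt ℝ h z.1)
    (ha' : DifferentiableAt ℝ a' z.1) (hb' : DifferentiableAt ℝ b' z.1)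
    (hc' : DifferentiableAt ℝ c' z.1) (hv : DifferentiableAt ℝ v z.1) (u p₁ p₂ : ℝ)
    (hp₁ : z.2 (EuclideanSpace.single 0 1) = p₁) (hp₂ : z.2 (EuclideanSpace.single 1 1) = p₂) :
    fderiv ℝ (localSimple a' b' c' v) z
      (stdHamiltonian (fderiv ℝ (localSimple a b c h) z) + (0, u • EuclideanSpace.proj 1)) =
    1 / 2 * (((a z.1 * p₁ + b z.1 * p₂) * partialDeriv 0 a' z.1 +
        (b z.1 * p₁ + c z.1 * p₂) * partialDeriv 1 a' z.1) * p₁ ^ 2 +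
      2 * ((a z.1 * p₁ + b z.1 * p₂) * partialDeriv 0 b' z.1 +
        (b z.1 * p₁ + c z.1 * p₂) * partialDeriv 1 b' z.1) * p₁ * p₂ +
      ((a z.1 * p₁ + b z.1 * p₂) * partialDeriv 0 c' z.1 +
        (b z.1 * p₁ + c z.1 * p₂) * partialDeriv 1 c' z.1) * p₂ ^ 2) +
      ((a z.1 * p₁ + b z.1 * p₂) * partialDeriv 0 v z.1 +
        (b z.1 * p₁ + c z.1 * p₂) * partialDeriv 1 v z.1) +
      (a' z.1 * p₁ + b' z.1 * p₂) * -(1 / 2 * (partialDeriv 0 a z.1 * p₁ ^ 2 +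
        2 * partialDeriv 0 b z.1 * p₁ * p₂ + partialDeriv 0 c z.1 * p₂ ^ 2) +
          partialDeriv 0 h z.1) +
      (b' z.1 * p₁ + c' z.1 * p₂) * (-(1 / 2 * (partialDeriv 1 a z.1 * p₁ ^ 2 +
        2 * partialDeriv 1 b z.1 * p₁ * p₂ + partialDeriv 1 c z.1 * p₂ ^ 2) +
          partialDeriv 1 h z.1) + u) := by
  have hX : stdHamiltonian (fderiv ℝ (localSimple a b c h) z) + (0, u • EuclideanSpace.proj 1) =
      ((a z.1 * p₁ + b z.1 * p₂) • EuclideanSpace.single 0 1 +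
        (b z.1 * p₁ + c z.1 * p₂) • EuclideanSpace.single 1 1,
        -(fderiv ℝ (localSimple a b c h) z).comp (ContinuousLinearMap.inl ℝ E2 E2Dual) +
          u • EuclideanSpace.proj 1) := by
    refine Prod.ext ?_ rfl
    simp only [stdHamiltonian, Prod.fst_add, add_zero]
    rw [fderiv_localSimple ha hb hc hh, fderiv_localSimple ha hb hc hh, hp₁, hp₂]
    simp
  rw [hX, fderiv_localSimple ha' hb' hc' hv, hp₁, hp₂]
  simp only [add_apply, neg_apply, ContinuousLinearMap.comp_apply,
    ContinuousLinearMap.inl_apply, fderiv_localSimple ha hb hc hh, hp₁, hp₂]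
  simp [partialDeriv]

/-- Near a critical point that satisfies the positivity condition, a force along the second
coordinate turns a positive definite simple function into a first integral. -/
theorem exists_control {Ω : Set E2} (hΩ : IsOpen Ω) (h0 : (0 : E2) ∈ Ω) {a b c h : E2 → ℝ}
    (ha : ContDiffOn ℝ ∞ a Ω) (hb : ContDiffOn ℝ ∞ b Ω) (hc : ContDiffOn ℝ ∞ c Ω)
    (hh : ContDiffOn ℝ ∞ h Ω) (hc0 : ∀ z ∈ Ω, 0 < c z)
    (hdet : ∀ z ∈ Ω, 0 < a z * c z - b z ^ 2) (hcrit : fderiv ℝ h 0 = 0)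
    (hpos : b 0 * partialDeriv 0 (partialDeriv 0 h) 0 +
      c 0 * partialDeriv 1 (partialDeriv 0 h) 0 ≠ 0 ∨ 0 < partialDeriv 0 (partialDeriv 0 h) 0) :
    ∃ (U : Set E2) (al be ga v : E2 → ℝ) (u : E2 × E2Dual → ℝ), IsOpen U ∧ 0 ∈ U ∧ U ⊆ Ω ∧
      ContDiffOn ℝ ∞ al U ∧ ContDiffOn ℝ ∞ be U ∧ ContDiffOn ℝ ∞ ga U ∧ ContDiffOn ℝ ∞ v U ∧
      ContDiffOn ℝ ∞ u (U ×ˢ univ) ∧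
      (∀ z ∈ U, 0 < al z ∧ al z * ga z - be z ^ 2 = 1) ∧ v 0 = 0 ∧
      (∀ z ∈ U, z ≠ 0 → 0 < v z) ∧ u 0 = 0 ∧
      ∀ z ∈ U ×ˢ (univ : Set E2Dual), fderiv ℝ (localSimple ga (fun z => -be z) al v) z
        (stdHamiltonian (fderiv ℝ (localSimple a b c h) z) +
          (0, u z • EuclideanSpace.proj 1)) = 0 := by
  obtain ⟨U, al, be, v, hU, h0U, hUΩ, hal, hbe, hv, hal0, hv0, hvpos, hmatch⟩ :=
    exists_matching hΩ h0 ha hb hc hh hc0 hdet hcrit hpos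
  have ha := ha.mono hUΩ
  have hb := hb.mono hUΩ
  have hc := hc.mono hUΩ
  have hh := hh.mono hUΩ
  set ga : E2 → ℝ := fun z => (be z ^ 2 + 1) / al z with hga
  have hgas : ContDiffOn ℝ ∞ ga U :=
    ((hbe.pow 2).add contDiffOn_const).div hal fun z hz => (hal0 z hz).ne'
  have hdetg : ∀ z ∈ U, al z * ga z - be z ^ 2 = 1 := by
    intro z hz
    have := (hal0 z hz).ne'
    simp only [hga]
    field_simp
    ring
  have hpd : ∀ {f : E2 → ℝ} (i : Fin 2), ContDiffOn ℝ ∞ f U →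
      ContDiffOn ℝ ∞ (fun z : E2 × E2Dual => partialDeriv i f z.1) (U ×ˢ univ) :=
    fun i hf => contDiffOn_comp_fst (contDiffOn_partialDeriv hU hf i)
  have hdiff : ∀ {f : E2 → ℝ}, ContDiffOn ℝ ∞ f U → ∀ z ∈ U, DifferentiableAt ℝ f z :=
    fun hf z hz => (hf.contDiffAt (hU.mem_nhds hz)).differentiableAt (by simp)
  have hdetd : ∀ z ∈ U, ∀ i : Fin 2, partialDeriv i al z * ga z + al z * partialDeriv i ga z -
      2 * be z * partialDeriv i be z = 0 := by
    intro z hz i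
    have h1 := ((hdiff hal z hz).hasFDerivAt.mul (hdiff hgas z hz).hasFDerivAt).sub
      ((hdiff hbe z hz).hasFDerivAt.pow 2)
    have h2 : HasFDerivAt (fun _ : E2 => (1 : ℝ)) (0 : E2 →L[ℝ] ℝ) z := hasFDerivAt_const 1 z
    have h3 := h1.unique (h2.congr_of_eventuallyEq
      ((hU.eventually_mem hz).mono fun w hw => hdetg w hw))
    have h4 := DFunLike.congr_fun h3 (EuclideanSpace.single i (1 : ℝ))
    simp at h4
    simp only [partialDeriv]
    linarith
  refine ⟨U, al, be, ga, v, fun z => controlValue (a z.1) (b z.1) (c z.1)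
    (partialDeriv 0 a z.1) (partialDeriv 0 b z.1) (partialDeriv 0 c z.1)
    (partialDeriv 1 a z.1) (partialDeriv 1 b z.1) (partialDeriv 1 c z.1) (partialDeriv 1 h z.1)
    (al z.1) (be z.1) (ga z.1)
    (partialDeriv 0 al z.1) (partialDeriv 0 be z.1) (partialDeriv 0 ga z.1)
    (partialDeriv 1 al z.1) (partialDeriv 1 be z.1) (partialDeriv 1 ga z.1)
    (partialDeriv 0 v z.1) (partialDeriv 1 v z.1)
    (z.2 (EuclideanSpace.single 0 1)) (z.2 (EuclideanSpace.single 1 1)),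
    hU, h0U, hUΩ, hal, hbe, hgas, hv, ?_, fun z hz => ⟨hal0 z hz, hdetg z hz⟩, hv0, hvpos, ?_, ?_⟩
  · exact contDiffOn_controlValue (contDiffOn_comp_fst ha) (contDiffOn_comp_fst hb)
      (contDiffOn_comp_fst hc) (hpd 0 ha) (hpd 0 hb) (hpd 0 hc) (hpd 1 ha) (hpd 1 hb) (hpd 1 hc)
      (hpd 1 hh) (contDiffOn_comp_fst hal) (contDiffOn_comp_fst hbe) (contDiffOn_comp_fst hgas)
      (hpd 0 hal) (hpd 0 hbe) (hpd 0 hgas) (hpd 1 hal) (hpd 1 hbe) (hpd 1 hgas)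
      (hpd 0 hv) (hpd 1 hv) (contDiffOn_evalSnd _ _) (contDiffOn_evalSnd _ _)
  -- At the origin p, dh and dv all vanish, the last because v has a minimum there. Every term of
  -- the control then vanishes, so the critical point is preserved.
  · have hmin : IsLocalMin v 0 := by
      filter_upwards [hU.mem_nhds h0U] with z hz
      rw [hv0]
      by_cases hz0 : z = 0
      · rw [hz0, hv0]
      · exact (hvpos z hz hz0).le
    simp [controlValue, partialDeriv, hmin.fderiv_eq_zero, hcrit]
  · rintro z ⟨hz, -⟩
    rw [fderiv_localSimple_stdHamiltonian (hdiff ha _ hz) (hdiff hb _ hz) (hdiff hc _ hz)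
      (hdiff hh _ hz) (hdiff hgas _ hz) (hdiff hbe.neg _ hz) (hdiff hal _ hz) (hdiff hv _ hz)
      _ _ _ rfl rfl, partialDeriv_neg, partialDeriv_neg]
    have hs := controlValue_spec (dya := partialDeriv 1 a z.1) (dyb := partialDeriv 1 b z.1)
      (dyc := partialDeriv 1 c z.1) (hy := partialDeriv 1 h z.1)
      (p₁ := z.2 (EuclideanSpace.single 0 1)) (p₂ := z.2 (EuclideanSpace.single 1 1))
      (hdetg _ hz) (hdetd _ hz 0) (hdetd _ hz 1) (hmatch _ hz).1 (hmatch _ hz).2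
    refine Eq.trans ?_ hs
    ring

end LocalConstruction
end LCB

namespace LCB

/-! ### Lyapunov's theorem on T*U from its coordinate version. -/

section Transport

variable {Q : Type*} [TopologicalSpace Q] [ChartedSpace E2 Q] [IsManifold (𝓡 2) ∞ Q]
  {φ : OpenPartialHomeomorph Q E2}

theorem hasMFDerivAt_lift (hφ : φ ∈ IsManifold.maximalAtlas (𝓡 2) ∞ Q) {z : E2 × E2Dual}
    (hz : z.1 ∈ φ.target) :
    HasMFDerivAt 𝓘(ℝ, E2 × E2Dual) cotModel (cotangentLift φ : _ → CotangentBundle Q) z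
      (cotangentDeriv φ (cotangentLift φ z : CotangentBundle Q)).inverse := by
  have h1 := ((contMDiffAt_cotangentLift hφ hz).mdifferentiableAt (by simp)).hasMFDerivAt
  have hα : (cotangentLift φ z : CotangentBundle Q).proj ∈ φ.source := φ.map_target hz
  have h2 := (hasMFDerivAt_cotangentCoord hφ hα).comp z h1
  have e : (cotangentCoord φ ∘ cotangentLift φ : E2 × E2Dual → _) =ᶠ[𝓝 z] id :=
    (eventually_fst_mem φ.open_target hz).mono fun w hw => cotangentCoord_lift hφ hw
  have h3 := hasMFDerivAt_unique h2 ((hasMFDerivAt_id z).congr_of_eventuallyEq e)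
  refine h1.congr_mfderiv ?_
  ext1 w
  symm
  apply cotangentDeriv_injective hφ hα
  refine (cotangentDeriv_inverse hφ hα w).trans ?_
  exact (DFunLike.congr_fun h3 w).symm

/-- Lyapunov's theorem for a vector field on a part `T*U` of the cotangent bundle over the domain
of a chart, stated for its expression in the coordinates of the chart. -/
theorem isStableAt_of_coord (hφ : φ ∈ IsManifold.maximalAtlas (𝓡 2) ∞ Q) {q₀ : Q}
    (hq₀ : q₀ ∈ φ.source) (hφ0 : φ q₀ = 0) {U : Set E2} (hU : IsOpen U) (h0 : (0 : E2) ∈ U)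
    (hUt : U ⊆ φ.target) {X : ∀ α : CotangentBundle Q, TangentSpace cotModel α}
    {X' : E2 × E2Dual → E2 × E2Dual} (hX' : ContDiffOn ℝ ∞ X' (U ×ˢ univ))
    (hX : ∀ α ∈ (cotangentOver (φ.source ∩ φ ⁻¹' U) : Set (CotangentBundle Q)),
      cotangentDeriv φ α (X α) = X' (cotangentCoord φ α))
    (hX0 : X (nullPoint q₀) = 0) {V : E2 × E2Dual → ℝ}
    (hV : DifferentiableOn ℝ V (U ×ˢ univ)) (hV0 : V 0 = 0)
    (hpos : ∀ z ∈ U ×ˢ (univ : Set E2Dual), z ≠ 0 → 0 < V z)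
    (hdec : ∀ z ∈ U ×ˢ (univ : Set E2Dual), fderiv ℝ V z (X' z) ≤ 0) :
    IsStableAt cotModel X (cotangentOver (φ.source ∩ φ ⁻¹' U)) (nullPoint q₀) := by
  set D : Set (CotangentBundle Q) := cotangentOver (φ.source ∩ φ ⁻¹' U) with hD
  have hDo : IsOpen D := isOpen_cotangentOver (φ.isOpen_inter_preimage hU)
  have hmem : nullPoint q₀ ∈ D := ⟨hq₀, by rw [mem_preimage]; show φ q₀ ∈ U; rwa [hφ0]⟩
  have hnull : cotangentCoord φ (nullPoint q₀) = 0 := cotangentCoord_nullPoint hφ0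
  have hlift0 : (cotangentLift φ 0 : CotangentBundle Q) = nullPoint q₀ := by
    rw [← hnull, cotangentLift_coord hφ hmem.1]
  have hliftD : ∀ z ∈ U ×ˢ (univ : Set E2Dual), (cotangentLift φ z : CotangentBundle Q) ∈ D := by
    intro z hz
    refine ⟨φ.map_target (hUt hz.1), ?_⟩
    rw [mem_preimage]
    show φ (φ.symm z.1) ∈ U
    rw [φ.right_inv (hUt hz.1)]
    exact hz.1
  refine ⟨hmem, hX0, fun N hN => ?_⟩
  have hNl : (cotangentLift φ : _ → CotangentBundle Q) ⁻¹' N ∈ 𝓝 (0 : E2 × E2Dual) := by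
    apply (contMDiffAt_cotangentLift hφ (z := 0) (hUt h0)).continuousAt
    rwa [hlift0]
  obtain ⟨N', hN', hst⟩ := lyapunov_stable (hU.prod isOpen_univ)
    (show (0 : E2 × E2Dual) ∈ U ×ˢ univ from ⟨h0, mem_univ _⟩) hX' hV hV0 hpos hdec hNl
  -- The coordinates are controlled only over the chart domain, hence the intersection with `D`.
  refine ⟨D ∩ cotangentCoord φ ⁻¹' N', inter_mem (hDo.mem_nhds hmem) ?_, ?_⟩
  · apply (contMDiffAt_cotangentCoord hφ hmem.1).continuousAt
    rwa [hnull]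
  rintro α ⟨hαD, hαN⟩
  obtain ⟨⟨γ, hγ0, hγ⟩, hall⟩ := hst _ hαN
  constructor
  · refine ⟨fun t => cotangentLift φ (γ t), ?_, fun t ht => hliftD _ (hγ t ht).1, ?_⟩
    · simp only [hγ0]
      exact cotangentLift_coord hφ hαD.1
    · intro t ht
      obtain ⟨hγD, hγ'⟩ := hγ t ht
      have hm := hUt hγD.1
      have h1 := (hasMFDerivAt_lift hφ hm).comp t hγ'.hasFDerivAt.hasMFDerivAt
      refine HasMFDerivAt.hasMFDerivWithinAt (h1.congr_mfderiv ?_)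
      have hcoord : cotangentCoord φ (cotangentLift φ (γ t) : CotangentBundle Q) = γ t :=
        cotangentCoord_lift hφ hm
      have hinv : (cotangentDeriv φ (cotangentLift φ (γ t) : CotangentBundle Q)).inverse
          (X' (γ t)) = X (cotangentLift φ (γ t)) := by
        apply cotangentDeriv_injective hφ (hliftD _ hγD).1
        rw [cotangentDeriv_inverse hφ (hliftD _ hγD).1, hX _ (hliftD _ hγD), hcoord]
      refine ContinuousLinearMap.ext fun (r : ℝ) => ?_
      refine Eq.trans ?_ (congrArg (fun w => r • w) hinv)
      exact map_smul (cotangentDeriv φ (cotangentLift φ (γ t) : CotangentBundle Q)).inverse r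
        (X' (γ t))
  · intro Γ τ hΓ0 hΓD hΓ t ht
    have hcurve : ∀ s ∈ Ico 0 τ, HasDerivWithinAt (fun s => cotangentCoord φ (Γ s))
        (X' (cotangentCoord φ (Γ s))) (Ico 0 τ) s := by
      intro s hs
      have h1 := (hasMFDerivAt_cotangentCoord hφ (hΓD s hs).1).comp_hasMFDerivWithinAt s (hΓ s hs)
      have h2 : HasFDerivWithinAt (fun s => cotangentCoord φ (Γ s))
          ((1 : ℝ →L[ℝ] ℝ).smulRight (X' (cotangentCoord φ (Γ s)))) (Ico 0 τ) s := by
        refine hasMFDerivWithinAt_iff_hasFDerivWithinAt.1 (h1.congr_mfderiv ?_)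
        refine ContinuousLinearMap.ext fun (r : ℝ) => ?_
        refine (map_smul (cotangentDeriv φ (Γ s)) r (X (Γ s))).trans ?_
        rw [hX _ (hΓD s hs)]
        rfl
      simpa using h2.hasDerivWithinAt
    have := hall _ τ (by rw [hΓ0]) hcurve t ht
    rw [mem_preimage, cotangentLift_coord hφ (hΓD t ht).1] at this
    exact this

end Transport
end LCB

namespace LCB

/-! ### Positivity and smoothness of the constructed data. -/

section Data

/-- The bilinear form on `ℝ²` with matrix `!![al, be; be, ga]`. -/
noncomputable def coeffForm (al be ga : ℝ) : E2 →L[ℝ] E2 →L[ℝ] ℝ :=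
  al • (EuclideanSpace.proj 0 : E2 →L[ℝ] ℝ).smulRight (EuclideanSpace.proj 0 : E2 →L[ℝ] ℝ) +
    be • (EuclideanSpace.proj 0 : E2 →L[ℝ] ℝ).smulRight (EuclideanSpace.proj 1 : E2 →L[ℝ] ℝ) +
    be • (EuclideanSpace.proj 1 : E2 →L[ℝ] ℝ).smulRight (EuclideanSpace.proj 0 : E2 →L[ℝ] ℝ) +
    ga • (EuclideanSpace.proj 1 : E2 →L[ℝ] ℝ).smulRight (EuclideanSpace.proj 1 : E2 →L[ℝ] ℝ)

theorem coeffForm_apply (al be ga : ℝ) (x y : E2) :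
    coeffForm al be ga x y =
      al * (x 0 * y 0) + be * (x 0 * y 1) + be * (x 1 * y 0) + ga * (x 1 * y 1) := by
  simp [coeffForm]

/-- Completing the square: al times the form is (al x₀ + be x₁)² + x₁², because the determinant is
1. -/
theorem coeffForm_pos {al be ga : ℝ} (hal : 0 < al) (hdet : al * ga - be ^ 2 = 1) {x : E2}
    (hx : x ≠ 0) : 0 < coeffForm al be ga x x := by
  rw [coeffForm_apply]
  have h1 : al * (al * (x 0 * x 0) + be * (x 0 * x 1) + be * (x 1 * x 0) + ga * (x 1 * x 1)) =
      (al * x 0 + be * x 1) ^ 2 + x 1 ^ 2 := by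
    linear_combination x 1 ^ 2 * hdet
  refine pos_of_mul_pos_right (a := al) ?_ hal.le
  rw [h1]
  by_cases h : x 1 = 0
  · have h0 : x 0 ≠ 0 := by
      intro h0
      apply hx
      ext i
      fin_cases i
      · exact h0
      · exact h
    have : al * x 0 ≠ 0 := mul_ne_zero hal.ne' h0
    rw [h, mul_zero, add_zero]
    positivity
  · positivity

theorem contDiffOn_coeffForm {U : Set E2} {al be ga : E2 → ℝ} (hal : ContDiffOn ℝ ∞ al U)
    (hbe : ContDiffOn ℝ ∞ be U) (hga : ContDiffOn ℝ ∞ ga U) :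
    ContDiffOn ℝ ∞ (fun z => coeffForm (al z) (be z) (ga z)) U := by
  refine contDiffOn_clm_apply.2 fun x => contDiffOn_clm_apply.2 fun y => ?_
  simp only [coeffForm_apply]
  exact (((hal.mul contDiffOn_const).add (hbe.mul contDiffOn_const)).add
    (hbe.mul contDiffOn_const)).add (hga.mul contDiffOn_const)

/-- Away from the origin of the base the potential is positive and the kinetic part nonnegative.
Over the origin p is nonzero, and completing the square makes the kinetic part positive. -/
theorem localSimple_pos {a b c v : E2 → ℝ} {U : Set E2}
    (hc : ∀ z ∈ U, 0 < c z ∧ c z * a z - b z ^ 2 = 1) (hv0 : v 0 = 0)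
    (hv : ∀ z ∈ U, z ≠ 0 → 0 < v z) {z : E2 × E2Dual} (hz : z.1 ∈ U) (hz0 : z ≠ 0) :
    0 < localSimple a b c v z := by
  obtain ⟨x, p⟩ := z
  obtain ⟨hc0, hdet⟩ := hc x hz
  set p₁ := p (EuclideanSpace.single 0 1) with hp₁
  set p₂ := p (EuclideanSpace.single 1 1) with hp₂
  have hcp : c x * (a x * p₁ ^ 2 + 2 * b x * p₁ * p₂ + c x * p₂ ^ 2) =
      (c x * p₂ + b x * p₁) ^ 2 + p₁ ^ 2 := by
    linear_combination p₁ ^ 2 * hdet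
  show 0 < 1 / 2 * (a x * p₁ ^ 2 + 2 * b x * p₁ * p₂ + c x * p₂ ^ 2) + v x
  have hk : 0 ≤ a x * p₁ ^ 2 + 2 * b x * p₁ * p₂ + c x * p₂ ^ 2 := by
    refine (mul_nonneg_iff_of_pos_left hc0).1 ?_
    rw [hcp]
    positivity
  by_cases hx : x = 0
  · have hp : p₁ ≠ 0 ∨ p₂ ≠ 0 := by
      by_contra! hcon
      apply hz0
      rw [hx, covector_eq p, ← hp₁, ← hp₂, hcon.1, hcon.2]
      simp
    have hk' : 0 < a x * p₁ ^ 2 + 2 * b x * p₁ * p₂ + c x * p₂ ^ 2 := by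
      refine pos_of_mul_pos_right (a := c x) ?_ hc0.le
      rw [hcp]
      by_cases h : p₁ = 0
      · have : c x * p₂ ≠ 0 := mul_ne_zero hc0.ne' (hp.resolve_left (by simpa using h))
        rw [h, mul_zero, add_zero]
        positivity
      · positivity
    rw [hx] at hk' ⊢
    rw [hv0]
    linarith
  · have := hv x hz hx
    linarith

theorem contDiffOn_stdHamiltonian {D : Set (E2 × E2Dual)} (hD : IsOpen D) {H : E2 × E2Dual → ℝ}
    (hH : ContDiffOn ℝ ∞ H D) : ContDiffOn ℝ ∞ (fun z => stdHamiltonian (fderiv ℝ H z)) D := by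
  have h1 : ContDiffOn ℝ ∞ (fderiv ℝ H) D := hH.fderiv_of_isOpen hD (by simp)
  exact (((h1.clm_apply contDiffOn_const).smul contDiffOn_const).add
    ((h1.clm_apply contDiffOn_const).smul contDiffOn_const)).prodMk
      (h1.clm_comp contDiffOn_const).neg

end Data

/-! ### The control as a vertical vector field on T*U. -/

section Transport

variable {Q : Type*} [TopologicalSpace Q] [ChartedSpace E2 Q]
  {φ : OpenPartialHomeomorph Q E2}

theorem contDiffOn_comp_symm (hφ : φ ∈ IsManifold.maximalAtlas (𝓡 2) ∞ Q) {f : Q → ℝ}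
    (hf : ∀ q ∈ φ.source, ContMDiffAt (𝓡 2) 𝓘(ℝ, ℝ) ∞ f q) :
    ContDiffOn ℝ ∞ (fun z => f (φ.symm z)) φ.target := fun z hz =>
  (contMDiffAt_iff_contDiffAt.1
    ((hf _ (φ.map_target hz)).comp z (contMDiffAt_chart_symm hφ hz))).contDiffWithinAt

variable [IsManifold (𝓡 2) ∞ Q]

/-- The vertical vector field with component `u` along the second momentum. -/
noncomputable def controlField (φ : OpenPartialHomeomorph Q E2) (u : E2 × E2Dual → ℝ)
    (α : CotangentBundle Q) : TangentSpace cotModel α :=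
  (cotangentDeriv φ α).inverse (0, u (cotangentCoord φ α) • EuclideanSpace.proj 1)

theorem cotangentDeriv_controlField (hφ : φ ∈ IsManifold.maximalAtlas (𝓡 2) ∞ Q)
    (u : E2 × E2Dual → ℝ) {α : CotangentBundle Q} (hα : α.proj ∈ φ.source) :
    cotangentDeriv φ α (controlField φ u α) =
      (0, u (cotangentCoord φ α) • EuclideanSpace.proj 1) :=
  cotangentDeriv_inverse hφ hα _

theorem isSmoothVFOn_controlField (hφ : φ ∈ IsManifold.maximalAtlas (𝓡 2) ∞ Q) {U : Set E2}
    (hU : IsOpen U) {u : E2 × E2Dual → ℝ} (hu : ContDiffOn ℝ ∞ u (U ×ˢ univ)) :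
    IsSmoothVFOn (controlField φ u)
      (cotangentOver (φ.source ∩ φ ⁻¹' U) : Set (CotangentBundle Q)) := by
  intro α hα
  refine ContMDiffAt.contMDiffWithinAt ?_
  have hz : cotangentCoord φ α ∈ U ×ˢ (univ : Set E2Dual) := ⟨hα.2, mem_univ _⟩
  have hvf : ContDiffAt ℝ ∞ (fun z : E2 × E2Dual =>
      ((0, u z • EuclideanSpace.proj 1) : E2 × E2Dual)) (cotangentCoord φ α) :=
    contDiffAt_const.prodMk
      ((hu.contDiffAt ((hU.prod isOpen_univ).mem_nhds hz)).smul contDiffAt_const)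
  exact (contMDiffAt_vectorSpace_iff_contDiffAt.2 hvf).mpullback_vectorField_preimage
    (contMDiffAt_cotangentCoord hφ hα.1) (isInvertible_cotangentDeriv hφ hα.1) (by simp)

/-- Adaptedness gives dy = kξ at each point, so the force u dy is uk times ξ. Smoothness of k is not
needed, since the field is built from dy. -/
theorem controlField_mem (hφ : φ ∈ IsManifold.maximalAtlas (𝓡 2) ∞ Q) (u : E2 × E2Dual → ℝ)
    {ξ : ∀ q : Q, TangentSpace (𝓡 2) q →L[ℝ] ℝ} (hξ : IsAdapted ξ φ) {α : CotangentBundle Q}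
    (hα : α.proj ∈ φ.source) : controlField φ u α ∈ actuation ξ α := by
  have h1 : coordDiff φ 1 α.proj ∈ Submodule.span ℝ {ξ α.proj} := by
    rw [hξ _ hα]
    exact Submodule.mem_span_singleton_self _
  obtain ⟨k, hk⟩ := Submodule.mem_span_singleton.1 h1
  refine Submodule.mem_span_singleton.2 ⟨u (cotangentCoord φ α) * k, ?_⟩
  apply cotangentDeriv_injective hφ hα
  rw [ContinuousLinearMap.map_smul, cotangentDeriv_vlift hφ hα,
    cotangentDeriv_controlField hφ u hα]
  have h2 : (k • ξ α.proj).comp (chartDeriv φ α.proj).inverse = EuclideanSpace.proj 1 := by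
    rw [hk, coordDiff_eq hφ hα, ContinuousLinearMap.comp_assoc,
      (isInvertible_chartDeriv hφ hα).self_comp_inverse]
    rfl
  rw [← h2]
  refine Prod.ext (smul_zero _) ?_
  ext v
  simp [mul_assoc]

end Transport
end LCB

namespace LCB

/-! ### The simple Lyapunov function on the manifold. -/

section Metric

variable {Q : Type*} [TopologicalSpace Q] [ChartedSpace E2 Q] {φ : OpenPartialHomeomorph Q E2}

theorem kineticMatrix_pos {g : ∀ q : Q, TangentSpace (𝓡 2) q →L[ℝ] TangentSpace (𝓡 2) q →L[ℝ] ℝ}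
    (hφ : φ ∈ IsManifold.maximalAtlas (𝓡 2) ∞ Q) {q : Q} (hq : q ∈ φ.source)
    (hsymm : ∀ u w, g q u w = g q w u) (hpos : ∀ u, u ≠ 0 → 0 < g q u u) :
    0 < kineticMatrix g φ q 1 1 ∧
      0 < kineticMatrix g φ q 0 0 * kineticMatrix g φ q 1 1 - kineticMatrix g φ q 0 1 ^ 2 := by
  obtain ⟨h00, h11, h10, hdet⟩ := gram_pos hφ hq hsymm hpos
  rw [kineticMatrix_eq, h10, ← sq]
  set D := gramCoeff g φ 0 0 q * gramCoeff g φ 1 1 q - gramCoeff g φ 0 1 q ^ 2 with hD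
  constructor
  · simpa using mul_pos (inv_pos.2 hdet) h00
  · have : D⁻¹ * gramCoeff g φ 1 1 q * (D⁻¹ * gramCoeff g φ 0 0 q) -
        (D⁻¹ * -gramCoeff g φ 0 1 q) ^ 2 = D⁻¹ := by
      have : D ≠ 0 := hdet.ne'
      field_simp
      rw [hD]
      ring
    have hpos' := inv_pos.2 hdet
    rw [← this] at hpos'
    exact hpos'

/-- With determinant 1 the inverse of the coefficient matrix is its adjugate, which explains the
coefficients ga, -be, al of the local Lyapunov function. -/
theorem kineticMatrix_pullbackForm (hφ : φ ∈ IsManifold.maximalAtlas (𝓡 2) ∞ Q) {q : Q}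
    (hq : q ∈ φ.source) {al be ga : E2 → ℝ} (hdet : al (φ q) * ga (φ q) - be (φ q) ^ 2 = 1) :
    kineticMatrix (pullbackForm φ fun z => coeffForm (al z) (be z) (ga z)) φ q =
      !![ga (φ q), -be (φ q); -be (φ q), al (φ q)] := by
  have h : ∀ i j, gramCoeff (pullbackForm φ fun z => coeffForm (al z) (be z) (ga z)) φ i j q =
      coeffForm (al (φ q)) (be (φ q)) (ga (φ q)) (EuclideanSpace.single i 1)
        (EuclideanSpace.single j 1) := by
    intro i j
    rw [gramCoeff, pullbackForm_apply, chartDeriv_coordVec hφ hq, chartDeriv_coordVec hφ hq]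
  rw [kineticMatrix_eq, h, h, h, h]
  simp only [coeffForm_apply]
  simp [← sq, hdet]

variable [IsManifold (𝓡 2) ∞ Q]

theorem contMDiffAt_kineticMatrix
    {g : ∀ q : Q, TangentSpace (𝓡 2) q →L[ℝ] TangentSpace (𝓡 2) q →L[ℝ] ℝ}
    (hφ : φ ∈ IsManifold.maximalAtlas (𝓡 2) ∞ Q) {q : Q} (hq : q ∈ φ.source)
    (hg : ContMDiffAt (𝓡 2) ((𝓡 2).prod 𝓘(ℝ, E2 →L[ℝ] E2 →L[ℝ] ℝ)) ∞
      (fun q : Q => TotalSpace.mk' (E2 →L[ℝ] E2 →L[ℝ] ℝ) q (g q)) q)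
    (hsymm : ∀ u w, g q u w = g q w u) (hpos : ∀ u, u ≠ 0 → 0 < g q u u) (i j : Fin 2) :
    ContMDiffAt (𝓡 2) 𝓘(ℝ, ℝ) ∞ (fun q => kineticMatrix g φ q i j) q := by
  have hs := contMDiffAt_gramCoeff hφ hq hg
  obtain ⟨h00, h11, h10, hdet⟩ := gram_pos hφ hq hsymm hpos
  have hD : ContMDiffAt (𝓡 2) 𝓘(ℝ, ℝ) ∞ (fun q => (gramCoeff g φ 0 0 q * gramCoeff g φ 1 1 q -
      gramCoeff g φ 0 1 q * gramCoeff g φ 1 0 q)⁻¹) q :=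
    (((hs 0 0).mul (hs 1 1)).sub ((hs 0 1).mul (hs 1 0))).inv₀ (by
      show gramCoeff g φ 0 0 q * gramCoeff g φ 1 1 q -
        gramCoeff g φ 0 1 q * gramCoeff g φ 1 0 q ≠ 0
      rw [h10, ← sq]
      exact hdet.ne')
  simp only [kineticMatrix_eq]
  fin_cases i <;> fin_cases j
  · exact hD.mul (hs 1 1)
  · exact hD.mul (hs 0 1).neg
  · exact hD.mul (hs 1 0).neg
  · exact hD.mul (hs 0 0)

theorem controlField_eq_zero {u : E2 × E2Dual → ℝ} {α : CotangentBundle Q}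
    (hu : u (cotangentCoord φ α) = 0) : controlField φ u α = 0 := by
  have h : ((0, u (cotangentCoord φ α) • EuclideanSpace.proj 1) : E2 × E2Dual) = 0 := by
    rw [hu]
    exact Prod.ext rfl (zero_smul ℝ _)
  rw [controlField, h]
  exact ContinuousLinearMap.map_zero _

/-- A metric and a potential given in the coordinates of `φ` define a simple function which is a
Lyapunov function as soon as its local expression is one. -/
theorem exists_simple_lyapunov (hφ : φ ∈ IsManifold.maximalAtlas (𝓡 2) ∞ Q) {q₀ : Q}
    (hq₀ : q₀ ∈ φ.source) (hφ0 : φ q₀ = 0) {U : Set E2} (hU : IsOpen U) (h0U : (0 : E2) ∈ U)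
    {al be ga v : E2 → ℝ} (hal : ContDiffOn ℝ ∞ al U) (hbe : ContDiffOn ℝ ∞ be U)
    (hga : ContDiffOn ℝ ∞ ga U) (hv : ContDiffOn ℝ ∞ v U)
    (hg : ∀ z ∈ U, 0 < al z ∧ al z * ga z - be z ^ 2 = 1) (hv0 : v 0 = 0)
    (hvpos : ∀ z ∈ U, z ≠ 0 → 0 < v z)
    {X : ∀ α : CotangentBundle Q, TangentSpace cotModel α} (hX0 : X (nullPoint q₀) = 0)
    (hdec : ∀ α ∈ (cotangentOver (φ.source ∩ φ ⁻¹' U) : Set (CotangentBundle Q)),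
      fderiv ℝ (localSimple ga (fun z => -be z) al v) (cotangentCoord φ α)
        (cotangentDeriv φ α (X α)) ≤ 0) :
    ∃ (g : ∀ q : Q, TangentSpace (𝓡 2) q →L[ℝ] TangentSpace (𝓡 2) q →L[ℝ] ℝ) (v : Q → ℝ),
      IsRiemannianMetricOn g (φ.source ∩ φ ⁻¹' U) ∧
      ContMDiffOn (𝓡 2) 𝓘(ℝ, ℝ) ∞ v (φ.source ∩ φ ⁻¹' U) ∧
      IsLyapunovOn cotModel X (simpleFn g v) (cotangentOver (φ.source ∩ φ ⁻¹' U))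
        (nullPoint q₀) := by
  have hVs : ContDiffOn ℝ ∞ (localSimple ga (fun z => -be z) al v) (U ×ˢ univ) :=
    contDiffOn_localSimple hga hbe.neg hal hv
  have hUo : IsOpen (φ.source ∩ φ ⁻¹' U) := φ.isOpen_inter_preimage hU
  have hq₀U : q₀ ∈ φ.source ∩ φ ⁻¹' U := ⟨hq₀, by rwa [mem_preimage, hφ0]⟩
  have hnull : cotangentCoord φ (nullPoint q₀) = 0 := cotangentCoord_nullPoint hφ0
  have hgsymm : ∀ q ∈ φ.source ∩ φ ⁻¹' U, ∀ x y,
      pullbackForm φ (fun z => coeffForm (al z) (be z) (ga z)) q x y =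
        pullbackForm φ (fun z => coeffForm (al z) (be z) (ga z)) q y x := by
    intro q _ x y
    simp only [pullbackForm_apply, coeffForm_apply]
    ring
  have hgpos : ∀ q ∈ φ.source ∩ φ ⁻¹' U, ∀ x, x ≠ 0 →
      0 < pullbackForm φ (fun z => coeffForm (al z) (be z) (ga z)) q x x := by
    intro q hq x hx
    rw [pullbackForm_apply]
    refine coeffForm_pos (hg _ hq.2).1 (hg _ hq.2).2 fun hx0 => hx ?_
    exact (isInvertible_chartDeriv hφ hq.1).injective (hx0.trans
      (ContinuousLinearMap.map_zero _).symm)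
  have hVeq : ∀ α ∈ (cotangentOver (φ.source ∩ φ ⁻¹' U) : Set (CotangentBundle Q)),
      simpleFn (pullbackForm φ fun z => coeffForm (al z) (be z) (ga z)) (fun q => v (φ q)) α =
        localSimple ga (fun z => -be z) al v (cotangentCoord φ α) := by
    intro α hα
    rw [simpleFn_eq hφ _ hα.1 (hgsymm _ hα) (hgpos _ hα),
      kineticMatrix_pullbackForm hφ hα.1 (hg _ hα.2).2]
    rfl
  have hVmem : ∀ α ∈ (cotangentOver (φ.source ∩ φ ⁻¹' U) : Set (CotangentBundle Q)),
      cotangentCoord φ α ∈ U ×ˢ (univ : Set E2Dual) := fun α hα => ⟨hα.2, mem_univ _⟩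
  refine ⟨pullbackForm φ fun z => coeffForm (al z) (be z) (ga z), fun q => v (φ q),
    ⟨hgsymm, hgpos, ?_⟩, ?_, ⟨hq₀U, hX0, ?_, ?_, ?_, ?_⟩⟩
  · intro q hq
    exact (contMDiffAt_pullbackForm hφ hq.1 ((contDiffOn_coeffForm hal hbe hga).contDiffAt
      (hU.mem_nhds hq.2))).contMDiffWithinAt
  · intro q hq
    exact ((hv.contDiffAt (hU.mem_nhds hq.2)).contMDiffAt.comp q
      (contMDiffAt_chart hφ hq.1)).contMDiffWithinAt
  · intro α hα
    refine ContMDiffWithinAt.congr (ContMDiffAt.contMDiffWithinAt ?_) hVeq (hVeq α hα)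
    exact ((hVs.contDiffAt ((hU.prod isOpen_univ).mem_nhds (hVmem α hα))).contMDiffAt).comp α
      (contMDiffAt_cotangentCoord hφ hα.1)
  · rw [hVeq _ hq₀U, hnull]
    simp [localSimple, hv0]
  · intro α hα hne
    rw [hVeq _ hα]
    refine localSimple_pos (fun z hz => ⟨(hg z hz).1, by rw [neg_sq]; exact (hg z hz).2⟩) hv0 hvpos
      (hVmem α hα).1 fun hz => hne ?_
    rw [← cotangentLift_coord hφ hα.1, hz, ← hnull, cotangentLift_coord hφ hq₀]
  · intro α hα
    have hVd : DifferentiableAt ℝ (localSimple ga (fun z => -be z) al v) (cotangentCoord φ α) :=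
      (hVs.contDiffAt ((hU.prod isOpen_univ).mem_nhds (hVmem α hα))).differentiableAt (by simp)
    have h1 := (hVd.hasFDerivAt.hasMFDerivAt.comp α
      (hasMFDerivAt_cotangentCoord hφ hα.1)).congr_of_eventuallyEq
        (((isOpen_cotangentOver hUo).eventually_mem hα).mono hVeq)
    rw [derivAlong, h1.mfderiv]
    exact hdec α hα

/-- The differential of the potential vanishes at the base point of a critical point of the
Hamiltonian vector field of a simple function. -/
theorem fderiv_eq_zero_of_stdHamiltonian {a b c k : E2 → ℝ} (ha : DifferentiableAt ℝ a 0)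
    (hb : DifferentiableAt ℝ b 0) (hc : DifferentiableAt ℝ c 0) (hk : DifferentiableAt ℝ k 0)
    (h : stdHamiltonian (fderiv ℝ (localSimple a b c k) 0) = 0) : fderiv ℝ k 0 = 0 := by
  ext x
  have h2 := DFunLike.congr_fun (congrArg Prod.snd h) x
  have h3 := fderiv_localSimple (z := 0) ha hb hc hk x 0
  have h4 : fderiv ℝ (localSimple a b c k) 0 (x, 0) = 0 := by
    simpa [stdHamiltonian] using h2
  rw [h4] at h3
  simpa using h3.symm

end Metric
end LCB

/-! ### Assembly in the adapted chart. -/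

theorem mainTheorem3 {Q : Type*} [TopologicalSpace Q] [T2Space Q] [SecondCountableTopology Q]
    [ChartedSpace LCB.E2 Q] [IsManifold (𝓡 2) ∞ Q]
    (ρ : ContMDiffRiemannianMetric (𝓡 2) ∞ LCB.E2 (fun q : Q => TangentSpace (𝓡 2) q))
    (h : Q → ℝ) (hh : ContMDiff (𝓡 2) 𝓘(ℝ, ℝ) ∞ h)
    (ξ : ∀ q : Q, TangentSpace (𝓡 2) q →L[ℝ] ℝ) (hξ : LCB.IsSmoothForm ξ)
    (hξ0 : ∀ q : Q, ξ q ≠ 0)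
    (q₀ : Q) (hcrit : LCB.hamiltonianVF (LCB.simpleFn ρ.inner h) (LCB.nullPoint q₀) = 0)
    (φ : OpenPartialHomeomorph Q LCB.E2) (hφ : φ ∈ IsManifold.maximalAtlas (𝓡 2) ∞ Q)
    (hq₀ : q₀ ∈ φ.source) (hφ0 : φ q₀ = 0) (hφξ : LCB.IsAdapted ξ φ)
    (hpos : LCB.PositivityCondition ρ.inner h φ q₀) :
    ∃ (U : Set Q) (Y : ∀ α : LCB.CotangentBundle Q, TangentSpace LCB.cotModel α),
      IsOpen U ∧ q₀ ∈ U ∧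
      LCB.IsSmoothVFOn Y (LCB.cotangentOver U) ∧
      (∀ α ∈ LCB.cotangentOver U, Y α ∈ LCB.actuation ξ α) ∧
      LCB.IsStableAt LCB.cotModel
        (fun α => LCB.hamiltonianVF (LCB.simpleFn ρ.inner h) α + Y α)
        (LCB.cotangentOver U) (LCB.nullPoint q₀) ∧
      ∃ (g : ∀ q : Q, TangentSpace (𝓡 2) q →L[ℝ] TangentSpace (𝓡 2) q →L[ℝ] ℝ) (v : Q → ℝ),
        LCB.IsRiemannianMetricOn g U ∧ ContMDiffOn (𝓡 2) 𝓘(ℝ, ℝ) ∞ v U ∧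
        LCB.IsLyapunovOn LCB.cotModel
          (fun α => LCB.hamiltonianVF (LCB.simpleFn ρ.inner h) α + Y α)
          (LCB.simpleFn g v) (LCB.cotangentOver U) (LCB.nullPoint q₀) := by
  open LCB in
  have hsymm : φ.symm 0 = q₀ := by rw [← hφ0, φ.left_inv hq₀]
  have h0 : (0 : E2) ∈ φ.target := by rw [← hφ0]; exact φ.map_source hq₀
  let A : Fin 2 → Fin 2 → E2 → ℝ := fun i j z => kineticMatrix ρ.inner φ (φ.symm z) i j
  let k : E2 → ℝ := fun z => h (φ.symm z)
  have hA : ∀ i j, ContDiffOn ℝ ∞ (A i j) φ.target := fun i j =>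
    contDiffOn_comp_symm hφ (f := fun q => kineticMatrix ρ.inner φ q i j) fun q hq =>
      contMDiffAt_kineticMatrix hφ hq ρ.contMDiff.contMDiffAt (ρ.symm q) (ρ.pos q) i j
  have hk : ContDiffOn ℝ ∞ k φ.target := contDiffOn_comp_symm hφ fun q _ => hh.contMDiffAt
  have hApos : ∀ z ∈ φ.target, 0 < A 1 1 z ∧ 0 < A 0 0 z * A 1 1 z - A 0 1 z ^ 2 := fun z hz =>
    kineticMatrix_pos hφ (φ.map_target hz) (ρ.symm _) (ρ.pos _)
  set H : E2 × E2Dual → ℝ := localSimple (A 0 0) (A 0 1) (A 1 1) k with hHdef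
  have hHs : ContDiffOn ℝ ∞ H (φ.target ×ˢ univ) :=
    contDiffOn_localSimple (hA 0 0) (hA 0 1) (hA 1 1) hk
  have hHeq : ∀ α : CotangentBundle Q, α.proj ∈ φ.source →
      simpleFn ρ.inner h α = H (cotangentCoord φ α) := by
    intro α hα
    rw [simpleFn_eq hφ h hα (ρ.symm _) (ρ.pos _)]
    simp only [hHdef, localSimple, A, k, cotangentCoord, φ.left_inv hα]
  have hXH : ∀ α : CotangentBundle Q, α.proj ∈ φ.source →
      cotangentDeriv φ α (hamiltonianVF (simpleFn ρ.inner h) α) =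
        stdHamiltonian (fderiv ℝ H (cotangentCoord φ α)) := by
    intro α hα
    refine cotangentDeriv_hamiltonianVF hφ hα ?_ ?_
    · exact (hHs.contDiffAt ((φ.open_target.prod isOpen_univ).mem_nhds
        ⟨φ.map_source hα, mem_univ _⟩)).differentiableAt (by simp)
    · exact (eventually_proj_mem φ.open_source hα).mono hHeq
  have hnull : cotangentCoord φ (nullPoint q₀) = 0 := cotangentCoord_nullPoint hφ0
  have hd : ∀ {f : E2 → ℝ}, ContDiffOn ℝ ∞ f φ.target → DifferentiableAt ℝ f 0 := fun hf =>
    (hf.contDiffAt (φ.open_target.mem_nhds h0)).differentiableAt (by simp)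
  -- On the null section the kinetic part has zero differential, so a critical point of X_H there is
  -- a critical point of the potential.
  have hkcrit : fderiv ℝ k 0 = 0 := by
    refine fderiv_eq_zero_of_stdHamiltonian (hd (hA 0 0)) (hd (hA 0 1)) (hd (hA 1 1)) (hd hk) ?_
    have hX := hXH (nullPoint q₀) hq₀
    rw [hcrit, hnull] at hX
    exact hX.symm.trans (cotangentDeriv φ (nullPoint q₀)).map_zero
  have hcond : A 0 1 0 * partialDeriv 0 (partialDeriv 0 k) 0 +
      A 1 1 0 * partialDeriv 1 (partialDeriv 0 k) 0 ≠ 0 ∨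
      0 < partialDeriv 0 (partialDeriv 0 k) 0 := by
    have h01 : ∀ i j, A i j 0 = kineticMatrix ρ.inner φ q₀ i j := fun i j => by
      simp only [A, hsymm]
    rw [h01, h01]
    exact hpos
  obtain ⟨U, al, be, ga, v, u, hU, h0U, hUt, hal, hbe, hga, hv, hu, hg, hv0, hvpos, hu0, hdec⟩ :=
    exists_control φ.open_target h0 (hA 0 0) (hA 0 1) (hA 1 1) hk (fun z hz => (hApos z hz).1)
      (fun z hz => (hApos z hz).2) hkcrit hcond
  set V : E2 × E2Dual → ℝ := localSimple ga (fun z => -be z) al v with hVdef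
  have hVs : ContDiffOn ℝ ∞ V (U ×ˢ univ) := contDiffOn_localSimple hga hbe.neg hal hv
  have hVpos : ∀ z ∈ U ×ˢ (univ : Set E2Dual), z ≠ 0 → 0 < V z := fun z hz hz0 =>
    localSimple_pos (fun z hz => ⟨(hg z hz).1, by rw [neg_sq]; exact (hg z hz).2⟩) hv0 hvpos
      hz.1 hz0
  have hV0 : V 0 = 0 := by simp [hVdef, localSimple, hv0]
  have hUo : IsOpen (φ.source ∩ φ ⁻¹' U) := φ.isOpen_inter_preimage hU
  have hX : ∀ α ∈ (cotangentOver (φ.source ∩ φ ⁻¹' U) : Set (CotangentBundle Q)),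
      cotangentDeriv φ α (hamiltonianVF (simpleFn ρ.inner h) α + controlField φ u α) =
        stdHamiltonian (fderiv ℝ H (cotangentCoord φ α)) +
          (0, u (cotangentCoord φ α) • EuclideanSpace.proj 1) := by
    intro α hα
    rw [ContinuousLinearMap.map_add, hXH α hα.1, cotangentDeriv_controlField hφ u hα.1]
  have hX0 : hamiltonianVF (simpleFn ρ.inner h) (nullPoint q₀) +
      controlField φ u (nullPoint q₀) = 0 := by
    rw [hcrit, controlField_eq_zero (by rw [hnull, hu0])]
    exact add_zero _
  have hq₀U : q₀ ∈ φ.source ∩ φ ⁻¹' U := ⟨hq₀, by rwa [mem_preimage, hφ0]⟩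
  refine ⟨φ.source ∩ φ ⁻¹' U, controlField φ u, hUo, hq₀U,
    isSmoothVFOn_controlField hφ hU hu, fun α hα => controlField_mem hφ u hφξ hα.1, ?_, ?_⟩
  · exact isStableAt_of_coord hφ hq₀ hφ0 hU h0U hUt
      (X' := fun z => stdHamiltonian (fderiv ℝ H z) + (0, u z • EuclideanSpace.proj 1))
      ((contDiffOn_stdHamiltonian (hU.prod isOpen_univ)
        (hHs.mono (prod_mono hUt subset_rfl))).add
          (contDiffOn_const.prodMk (hu.smul contDiffOn_const)))
      hX hX0 (hVs.differentiableOn (by simp)) hV0 hVpos (fun z hz => (hdec z hz).le)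
  · refine exists_simple_lyapunov hφ hq₀ hφ0 hU h0U hal hbe hga hv hg hv0 hvpos hX0
      fun α hα => ?_
    rw [hX α hα]
    exact (hdec (cotangentCoord φ α) ⟨hα.2, mem_univ _⟩).le
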